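/- **Setting.** For matrices $M_1,M_2\in\mathbb R^{n\times d}$ let $M_1\oslash M_2\in\mathbb R^{n^2\times d}$ be the matrix whose rows are the entrywise products of row $a$ of $M_1$ and row $b$ of $M_2$, for $(a,b)\in[n]^2$. Given $K_1,K_2,V_1,V_2\in\mathbb R^{n\times d}$, with rows $k_{1,i},k_{2,i},v_{1,i},v_{2,i}$, put $\widetilde K=K_1\oslash K_2$, $\widetilde V=V_1\oslash V_2$ and $\mathsf{Attn}(q,\widetilde K,\widetilde V)=\widetilde V^{\top}\,\mathsf{Softmax}(\widetilde K q)\in\mathbb R^d$. The two-cache stream consists of the $n^2$ triples (query $q_t$, row of $\widetilde K$, corresponding row of $\widetilde V$), $t=1,\dots,n^2$, the rows of $\widetilde K,\widetilde V$ being listed in some common order; $q$ denotes the last query $q_{n^2}$. A randomized streaming algorithm with $S$ bits of memory keeps a string of $S$ bits between consecutive triples; it may toss fresh coins at the start, at every update and when it produces its output after the last triple. Such algorithms are not required to be uniform in the parameters. All numbers in $q_t,K_1,K_2,V_1,V_2$ are finite-precision numbers: they lie in a set $A\subset\mathbb R$ (the number format), known to the algorithm. Throughout, $d=d(n)\ge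 2$ is an integer with $d=o(\log n)$. **Theorem (optimality of SubGen2Cache).** 1. (Upper bound.) For every $c$ there are constants $C,\kappa$ depending only on $c$ such that, for every $d=d(n)$ as above and every $r=r(n)$ with $|r|\le c\,|\log\log n|$ for all large $n$, the following holds for all sufficiently large $n$, all $\epsilon>0$, all integers $w\ge1$ and all finite $A\subset\mathbb R$ with $|A|\le 2^w$. There is a randomized streaming algorithm (a SubGen2Cache algorithm) with at most $$C\,w\,\epsilon^{-2}\,(\log n)^{\kappa}\cdot d\,e^{d}$$ bits of memory such that, for all inputs with numbers in $A$, with $\|k_{1,i}\|_2\le1$ and $\|k_{2,i}\|_2\le1$ for all $i\in[n]$, and with $\|q_t\|_2\le r$ for all $t\in[n^2]$, and for every order of the rows, its output $\widehat O$ satisfies, with probability at least $0.99$, $$\|\widehat O-\mathsf{Attn}(q,\widetilde K,\widetilde V)\|_2\le\epsilon\,\|\mathsf{Softmax}(\widetilde K q)\|_2\,\|\widetilde V\|_2 ,$$ where $\|\widetilde V\|_2$ is the spectral norm. In particular, for constant $\epsilon$ and numbers of $w=O(\log n)$ bits, the space is $\widetilde O(d e^d)$ bits, where $\widetilde O$ hides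 factors polylogarithmic in $n$. 2. (Essential optimality in the low-dimensional regime.) There is an absolute constant $c_0>0$ such that, for every $d=d(n)$ as above and every $\eta\in(0,1)$, the following holds for all sufficiently large $n$, every integer $p\ge\log_2 n$ and every order of the rows. Let the number format be $A=\{z/2^p: z\in\mathbb Z,\ |z/2^p|\le 2^p\}$. Every randomized streaming algorithm that, for all inputs with numbers in $A$ and with $\|k_{1,i}\|_2\le 1$, $\|k_{2,i}\|_2\le1$ for all $i\in[n]$ (the queries being otherwise unrestricted), outputs with probability at least $9/10$ an entrywise $(1\pm\eta)$-approximation $o$ of $Z=\mathsf{Attn}(q,\widetilde K,\widetilde V)$, i.e. $|o_j-Z_j|\le\eta|Z_j|$ for all $j\in[d]$, uses at least $c_0\,d\,e^d$ bits of memory. -/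

import Mathlib

open Filter Asymptotics
open scoped ENNReal

noncomputable section

namespace TensorCache

/-! ### Vectors, matrices and tensor attention -/

/-- The Euclidean norm of a real vector. -/
def l2 {ι : Type*} [Fintype ι] (x : ι → ℝ) : ℝ := √(∑ i, x i ^ 2)

/-- The spectral norm of a real matrix, i.e. the operator norm between Euclidean spaces. -/
def specNorm {ι κ : Type*} [Fintype ι] [Fintype κ] [DecidableEq κ] (M : Matrix ι κ ℝ) : ℝ :=
  ‖(Matrix.toEuclideanLin M).toContinuousLinearMap‖

/-- The softmax of a real vector. -/
def softmax {ι : Type*} [Fintype ι] (z : ι → ℝ) : ι → ℝ :=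
  fun j => Real.exp (z j) / ∑ k, Real.exp (z k)

/-- The column-wise Kronecker product: the row indexed by the pair `(a, b)` is the entrywise
product of row `a` of `M₁` and row `b` of `M₂`. The rows are kept indexed by pairs; the order in
which they are listed is chosen separately, see `Input.stream`. -/
def colKron {ι₁ ι₂ : Type*} {d : ℕ} (M₁ : Matrix ι₁ (Fin d) ℝ) (M₂ : Matrix ι₂ (Fin d) ℝ) :
    Matrix (ι₁ × ι₂) (Fin d) ℝ :=
  Matrix.of fun p j => M₁ p.1 j * M₂ p.2 j

/-- The attention function with two cache matrices, `Attn(q, K, V) = Vᵀ softmax(K q)`. -/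
def attn {ι : Type*} [Fintype ι] {d : ℕ} (q : Fin d → ℝ) (K V : Matrix ι (Fin d) ℝ) : Fin d → ℝ :=
  V.transpose.mulVec (softmax (K.mulVec q))

/-! ### Randomized streaming algorithms with `S` bits of memory -/

/-- A randomized streaming algorithm with `S` bits of memory, reading items of type `α` and
producing an output of type `β`. The whole state kept between two items is a string of `S` bits.
Fresh random coins may be tossed at the start, at each update and when the output is produced. -/
structure StreamAlg (S : ℕ) (α β : Type) where
  /-- the random initial memory -/
  init : PMF (Fin S → Bool)
  /-- the random new memory, given the old memory and the next item of the stream -/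
  update : (Fin S → Bool) → α → PMF (Fin S → Bool)
  /-- the random output, given the memory at the end of the stream -/
  output : (Fin S → Bool) → PMF β

namespace StreamAlg

variable {S : ℕ} {α β : Type}

/-- The law of the memory after the items of a list have been read, first item first. -/
def memory (A : StreamAlg S α β) (l : List α) : PMF (Fin S → Bool) :=
  l.foldl (fun μ x => μ.bind fun m => A.update m x) A.init

/-- The probability that the output after reading the list `l` lies in the set `E`. -/
def prob (A : StreamAlg S α β) (l : List α) (E : Set β) : ℝ≥0∞ :=
  ((A.memory l).bind A.output).toOuterMeasure E

end StreamAlg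

/-! ### The input of the two-cache problem -/

/-- The data behind a two-cache stream: the four original cache matrices of size `n × d`, and the
`n * n` query vectors accompanying the `n * n` rows of the two cache matrices. -/
structure Input (n d : ℕ) where
  /-- the queries -/
  q : Fin (n * n) → Fin d → ℝ
  /-- first key matrix; its rows are the key embeddings `k₁,ᵢ` -/
  K₁ : Matrix (Fin n) (Fin d) ℝ
  /-- second key matrix; its rows are the key embeddings `k₂,ᵢ` -/
  K₂ : Matrix (Fin n) (Fin d) ℝ
  /-- first value matrix -/
  V₁ : Matrix (Fin n) (Fin d) ℝ
  /-- second value matrix -/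
  V₂ : Matrix (Fin n) (Fin d) ℝ

namespace Input

variable {n d : ℕ}

/-- The key cache matrix `K̃ = K₁ ⊘ K₂`. -/
def keys (X : Input n d) : Matrix (Fin n × Fin n) (Fin d) ℝ := colKron X.K₁ X.K₂

/-- The value cache matrix `Ṽ = V₁ ⊘ V₂`. -/
def values (X : Input n d) : Matrix (Fin n × Fin n) (Fin d) ℝ := colKron X.V₁ X.V₂

/-- The last query of the stream (zero for the empty stream, `n = 0`). -/
def lastQuery (X : Input n d) : Fin d → ℝ :=
  if h : 0 < n * n then X.q ⟨n * n - 1, Nat.sub_lt h Nat.one_pos⟩ else 0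

/-- The softmax weights of the last query against all rows of `K̃`. -/
def weights (X : Input n d) : Fin n × Fin n → ℝ := softmax (X.keys.mulVec X.lastQuery)

/-- The attention output `Attn(q, K̃, Ṽ)` for the last query `q`. -/
def target (X : Input n d) : Fin d → ℝ := attn X.lastQuery X.keys X.values

/-- The stream of triples `(query, row of K̃, row of Ṽ)`, the rows being listed in the order `σ`. -/
def stream (X : Input n d) (σ : Fin (n * n) ≃ Fin n × Fin n) :
    List ((Fin d → ℝ) × (Fin d → ℝ) × (Fin d → ℝ)) :=
  List.ofFn fun t => (X.q t, X.keys (σ t), X.values (σ t))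

/-- All numbers of the input belong to the number format `A`. -/
def EntriesIn (X : Input n d) (A : Set ℝ) : Prop :=
  (∀ t j, X.q t j ∈ A) ∧
    ∀ i j, X.K₁ i j ∈ A ∧ X.K₂ i j ∈ A ∧ X.V₁ i j ∈ A ∧ X.V₂ i j ∈ A

/-- All key embeddings `k₁,ᵢ` and `k₂,ᵢ` lie in the Euclidean unit ball. -/
def KeysBounded (X : Input n d) : Prop := ∀ i, l2 (X.K₁ i) ≤ 1 ∧ l2 (X.K₂ i) ≤ 1

end Input

/-- An algorithm reading triples of `d`-dimensional vectors and producing such a vector. -/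
abbrev CacheAlg (S d : ℕ) : Type :=
  StreamAlg S ((Fin d → ℝ) × (Fin d → ℝ) × (Fin d → ℝ)) (Fin d → ℝ)

/-- The guarantee of the SubGen2Cache algorithm: on every input with numbers of format `A`, with
key embeddings in the unit ball and queries of norm at most `r`, and for every order of the rows,
the error is at most `ε ‖softmax(K̃ q)‖₂ ‖Ṽ‖₂` with probability at least `0.99`. -/
def CacheAlg.Approximates {S d : ℕ} (alg : CacheAlg S d) (n : ℕ) (r ε : ℝ) (A : Set ℝ) : Prop :=
  ∀ X : Input n d, X.EntriesIn A → X.KeysBounded → (∀ t, l2 (X.q t) ≤ r) →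
    ∀ σ : Fin (n * n) ≃ Fin n × Fin n,
      (99 / 100 : ℝ≥0∞) ≤ alg.prob (X.stream σ)
        {o | l2 (o - X.target) ≤ ε * l2 X.weights * specNorm X.values}

/-- The algorithm produces an (entrywise) `(1 ± η)`-approximation of the attention output with
probability at least `9/10`, on every input with numbers of format `A` and key embeddings in the
unit ball, the rows being listed in the order `σ`. -/
def CacheAlg.RelApproximates {S d : ℕ} (alg : CacheAlg S d) {n : ℕ}
    (σ : Fin (n * n) ≃ Fin n × Fin n) (η : ℝ) (A : Set ℝ) : Prop :=
  ∀ X : Input n d, X.EntriesIn A → X.KeysBounded →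
    (9 / 10 : ℝ≥0∞) ≤ alg.prob (X.stream σ) {o | ∀ j, |o j - X.target j| ≤ η * |X.target j|}

/-- Fixed-point numbers with `p` binary digits after the point, of absolute value at most `2 ^ p`. -/
def fixedPoint (p : ℕ) : Set ℝ := {x | (∃ z : ℤ, x = z / 2 ^ p) ∧ |x| ≤ 2 ^ p}

end TensorCache

end

open TensorCache

/-! Upper bound. Keys in the unit ball and queries of norm at most `r` keep every score in `[-r,
r]`, so the softmax is within factors `exp (± 2r)` of uniform, and uniform sampling suffices. Draw
`m` stream positions independently in advance, keep the triples found there and the latest triple,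
and output the self-normalized estimate. Its centred numerator is a sum of independent mean-zero
terms (`sum_sq_sum_sample`) and its denominator is at least `m * exp (-r)`; Chebyshev
(`card_bad_samples_le`) makes `m` of order `d * exp (4r) / ε ^ 2` enough. The factor `exp (4r)` is
polylogarithmic because `r = O(log log n)`. The bound uses only `1 ≤ exp d`: the exponential factor
is slack here.

Lower bound. Queries are now unrestricted, so a large query can make the softmax pick one row. With
keys on a parabola, completing the square turns the score of row `b` into a constant minus a large
multiple of the squared distance to the selected abscissa (`hardInput_score`). Storing `d` arbitrary
bits in each of about `n ^ (1/4)` rows and letting only the last query choose the row gives the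
one-way INDEX problem over an alphabet of size `2 ^ d`. An exponential-moment argument
(`index_weights_bound`) shows that the memory needs about `n ^ (1/4) * d` bits, and `exp d` is at
most the number of rows since `d = o(log n)`. -/

noncomputable section

namespace TensorCache

/-! ### Euclidean and spectral norms, softmax -/

section Norms

variable {ι κ : Type*} [Fintype ι] [Fintype κ]

theorem l2_nonneg (x : ι → ℝ) : 0 ≤ l2 x := Real.sqrt_nonneg _

theorem l2_sq (x : ι → ℝ) : l2 x ^ 2 = ∑ i, x i ^ 2 :=
  Real.sq_sqrt (Finset.sum_nonneg fun _ _ => sq_nonneg _)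

theorem l2_eq_norm (x : ι → ℝ) : l2 x = ‖WithLp.toLp 2 x‖ := by
  simp [l2, EuclideanSpace.norm_eq]

theorem abs_dotProduct_le (x y : ι → ℝ) : |∑ i, x i * y i| ≤ l2 x * l2 y := by
  refine abs_le_of_sq_le_sq ?_ (mul_nonneg (l2_nonneg x) (l2_nonneg y))
  rw [mul_pow, l2_sq, l2_sq]
  exact Finset.sum_mul_sq_le_sq_mul_sq _ _ _

theorem specNorm_nonneg [DecidableEq κ] (M : Matrix ι κ ℝ) : 0 ≤ specNorm M := norm_nonneg _

theorem l2_mulVec_le [DecidableEq κ] (M : Matrix ι κ ℝ) (x : κ → ℝ) :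
    l2 (M.mulVec x) ≤ specNorm M * l2 x := by
  rw [l2_eq_norm, l2_eq_norm]
  exact (Matrix.toEuclideanLin M).toContinuousLinearMap.le_opNorm (WithLp.toLp 2 x)

/-- With `x = Mᵀ w`, `‖x‖² = ⟨M x, w⟩ ≤ ‖M‖ ‖x‖ ‖w‖`; then cancel `‖x‖`. -/
theorem l2_transpose_mulVec_le [DecidableEq κ] (M : Matrix ι κ ℝ) (w : ι → ℝ) :
    l2 (M.transpose.mulVec w) ≤ specNorm M * l2 w := by
  set x := M.transpose.mulVec w with hx
  have h1 : l2 x ^ 2 = ∑ i, M.mulVec x i * w i := by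
    rw [l2_sq]
    calc ∑ j, x j ^ 2 = Matrix.vecMul w M ⬝ᵥ x := by
          rw [← Matrix.mulVec_transpose, ← hx]; simp [dotProduct, sq]
      _ = ∑ i, M.mulVec x i * w i := by
          rw [← Matrix.dotProduct_mulVec, dotProduct_comm]; rfl
  have h2 : l2 x ^ 2 ≤ specNorm M * l2 x * l2 w := by
    rw [h1]
    exact (le_abs_self _).trans ((abs_dotProduct_le _ _).trans
      (mul_le_mul_of_nonneg_right (l2_mulVec_le M x) (l2_nonneg w)))
  rcases (l2_nonneg x).eq_or_lt with h | h
  · rw [← h]; exact mul_nonneg (specNorm_nonneg M) (l2_nonneg w)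
  · nlinarith

/-- Each column is the image of a unit basis vector. -/
theorem sum_sq_le_card_mul_specNorm_sq [DecidableEq κ] (M : Matrix ι κ ℝ) :
    ∑ i, ∑ j, M i j ^ 2 ≤ Fintype.card κ * specNorm M ^ 2 := by
  rw [Finset.sum_comm]
  have h : ∀ j ∈ Finset.univ, ∑ i, M i j ^ 2 ≤ specNorm M ^ 2 := by
    intro j _
    have h1 := l2_mulVec_le M (Pi.single j 1)
    have h2 : l2 (Pi.single j 1 : κ → ℝ) = 1 := by
      rw [l2_eq_norm]; simp
    rw [h2, mul_one] at h1
    have h3 := pow_le_pow_left₀ (l2_nonneg _) h1 2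
    rw [l2_sq] at h3
    simpa [Matrix.mulVec_single] using h3
  calc _ ≤ ∑ _j : κ, specNorm M ^ 2 := Finset.sum_le_sum h
    _ = _ := by simp

theorem softmax_sum [Nonempty ι] (z : ι → ℝ) : ∑ i, softmax z i = 1 := by
  unfold softmax
  rw [← Finset.sum_div]
  exact div_self (Finset.sum_pos (fun _ _ => Real.exp_pos _) Finset.univ_nonempty).ne'

/-- Cauchy–Schwarz on the unit total mass. It lets the allowed error, which contains the softmax
norm, pay for the average squared size of the value rows. -/
theorem one_le_card_mul_l2_softmax_sq [Nonempty ι] (z : ι → ℝ) :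
    1 ≤ Fintype.card ι * l2 (softmax z) ^ 2 := by
  have h := sq_sum_le_card_mul_sum_sq (s := (Finset.univ : Finset ι)) (f := softmax z)
  rw [softmax_sum, one_pow] at h
  rw [l2_sq]
  exact h

theorem l2_attn_le {d : ℕ} (q : Fin d → ℝ) (K V : Matrix ι (Fin d) ℝ) :
    l2 (attn q K V) ≤ l2 (softmax (K.mulVec q)) * specNorm V := by
  rw [mul_comm]; exact l2_transpose_mulVec_le _ _

end Norms

/-! ### The self-normalized estimator for bounded scores -/

/-- The entries of a unit-ball vector are at most 1 in absolute value, so entrywise products of such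
vectors stay in the unit ball. -/
theorem abs_colKron_mulVec_le {ι κ : Type*} {d : ℕ} (M₁ : Matrix ι (Fin d) ℝ) (M₂ : Matrix κ (Fin d) ℝ)
    (h₁ : ∀ i, l2 (M₁ i) ≤ 1) (h₂ : ∀ i, l2 (M₂ i) ≤ 1) (q : Fin d → ℝ) (p : ι × κ) :
    |(colKron M₁ M₂).mulVec q p| ≤ l2 q := by
  have hk : l2 (colKron M₁ M₂ p) ≤ 1 := by
    have a1 : ∑ j, M₁ p.1 j ^ 2 ≤ 1 := by
      rw [← l2_sq]; exact pow_le_one₀ (l2_nonneg _) (h₁ _)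
    have a2 : ∑ j, M₂ p.2 j ^ 2 ≤ 1 := by
      rw [← l2_sq]; exact pow_le_one₀ (l2_nonneg _) (h₂ _)
    refine Real.sqrt_le_one.2 (le_trans (Finset.sum_le_sum fun j _ => ?_) a1)
    have : M₂ p.2 j ^ 2 ≤ 1 := le_trans
      (Finset.single_le_sum (f := fun j => M₂ p.2 j ^ 2) (fun _ _ => sq_nonneg _)
        (Finset.mem_univ j)) a2
    simp only [colKron, Matrix.of_apply, mul_pow]
    exact mul_le_of_le_one_right (sq_nonneg _) this
  calc |(colKron M₁ M₂).mulVec q p| ≤ l2 (colKron M₁ M₂ p) * l2 q := abs_dotProduct_le (colKron M₁ M₂ p) q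
    _ ≤ 1 * l2 q := mul_le_mul_of_nonneg_right hk (l2_nonneg q)
    _ = l2 q := one_mul _

/-- The self-normalized attention estimate from a list of sampled keys and values. -/
def sampleAttn {d m : ℕ} (q : Fin d → ℝ) (k v : Fin m → Fin d → ℝ) : Fin d → ℝ := fun j =>
  (∑ s, Real.exp (∑ l, k s l * q l) * v s j) / ∑ s, Real.exp (∑ l, k s l * q l)

/-- Subtracting `T` centres the numerator, and the random denominator is at least `m * exp (-ρ)` for
every sample. Only the second moment of a plain sum is left to estimate. -/
theorem l2_sampleAttn_sub_sq_le {ι : Type*} {d m : ℕ} (hm : 0 < m) (q : Fin d → ℝ) (K V : Matrix ι (Fin d) ℝ)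
    (ρ : ℝ) (hρ : ∀ i, |K.mulVec q i| ≤ ρ) (T : Fin d → ℝ) (τ : Fin m → ι) :
    l2 (sampleAttn q (fun s => K (τ s)) (fun s => V (τ s)) - T) ^ 2 ≤
      Real.exp (2 * ρ) / m ^ 2 *
        ∑ j, (∑ s, Real.exp (K.mulVec q (τ s)) * (V (τ s) j - T j)) ^ 2 := by
  set D := ∑ s, Real.exp (K.mulVec q (τ s)) with hD
  have hm' : (0 : ℝ) < m := by exact_mod_cast hm
  have hDle : m * Real.exp (-ρ) ≤ D := by
    have : ∑ _s : Fin m, Real.exp (-ρ) ≤ D :=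
      Finset.sum_le_sum fun s _ => Real.exp_le_exp.2 (abs_le.1 (hρ (τ s))).1
    simpa using this
  have hpos : 0 < m * Real.exp (-ρ) := by positivity
  have hD0 : 0 < D := hpos.trans_le hDle
  rw [l2_sq, Finset.mul_sum]
  refine Finset.sum_le_sum fun j _ => ?_
  have e1 : (sampleAttn q (fun s => K (τ s)) (fun s => V (τ s)) - T) j =
      (∑ s, Real.exp (K.mulVec q (τ s)) * (V (τ s) j - T j)) / D := by
    have : (sampleAttn q (fun s => K (τ s)) (fun s => V (τ s))) j =
      (∑ s, Real.exp (K.mulVec q (τ s)) * V (τ s) j) / D := rfl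
    rw [Pi.sub_apply, this]
    simp only [mul_sub, Finset.sum_sub_distrib, ← Finset.sum_mul]
    field_simp
    rw [← hD]; ring
  rw [e1, div_pow, div_mul_eq_mul_div, mul_comm, div_eq_mul_inv, mul_div_assoc, mul_comm]
  have h2 : (m * Real.exp (-ρ)) ^ 2 ≤ D ^ 2 := pow_le_pow_left₀ hpos.le hDle 2
  have h3 : (D ^ 2)⁻¹ ≤ Real.exp (2 * ρ) / m ^ 2 := by
    have : Real.exp (2 * ρ) / m ^ 2 = ((m * Real.exp (-ρ)) ^ 2)⁻¹ := by
      rw [mul_pow, ← Real.exp_nat_mul, mul_inv, ← Real.exp_neg, div_eq_mul_inv, mul_comm]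
      congr 2; push_cast; ring
    rw [this]
    exact inv_anti₀ (by positivity) h2
  calc _ ≤ (∑ s, Real.exp (K.mulVec q (τ s)) * (V (τ s) j - T j)) ^ 2 *
        (Real.exp (2 * ρ) / m ^ 2) := by
        rw [mul_comm]; exact mul_le_mul_of_nonneg_left h3 (sq_nonneg _)
    _ = _ := by ring

/-! ### Second moments of uniform samples -/

section Sampling

variable {ι : Type*} [Fintype ι]

theorem sum_fun_fin_succ {m : ℕ} (F : (Fin (m + 1) → ι) → ℝ) :
    ∑ τ, F τ = ∑ i, ∑ τ : Fin m → ι, F (Fin.cons i τ) := by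
  rw [← (Fin.consEquiv fun _ => ι).sum_comp F, Fintype.sum_prod_type]
  rfl

/-- The variance of a sum of `m` independent mean-zero variables, written as a count over all
samples. In the induction the cross term carries the factor `∑ i, f i = 0`. -/
theorem sum_sq_sum_sample (f : ι → ℝ) (hf : ∑ i, f i = 0) (m : ℕ) :
    (Fintype.card ι : ℝ) * ∑ τ : Fin m → ι, (∑ s, f (τ s)) ^ 2 =
      m * (Fintype.card ι : ℝ) ^ m * ∑ i, f i ^ 2 := by
  induction m with
  | zero => simp
  | succ m ih =>
    have h : ∑ τ : Fin (m + 1) → ι, (∑ s, f (τ s)) ^ 2 =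
        (Fintype.card ι : ℝ) ^ m * ∑ i, f i ^ 2 +
          Fintype.card ι * ∑ τ : Fin m → ι, (∑ s, f (τ s)) ^ 2 := by
      rw [sum_fun_fin_succ]
      have h1 : ∀ i, ∑ τ : Fin m → ι, (∑ s, f ((Fin.cons i τ : Fin (m + 1) → ι) s)) ^ 2 =
          (Fintype.card ι : ℝ) ^ m * f i ^ 2 + f i * (2 * ∑ τ : Fin m → ι, ∑ s, f (τ s)) +
            ∑ τ : Fin m → ι, (∑ s, f (τ s)) ^ 2 := by
        intro i
        simp only [Fin.sum_univ_succ, Fin.cons_zero, Fin.cons_succ, add_sq, Finset.sum_add_distrib,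
          Finset.sum_const, Finset.card_univ, Fintype.card_fun, Fintype.card_fin, nsmul_eq_mul,
          Nat.cast_pow, Finset.mul_sum]
        congr 2
        exact Finset.sum_congr rfl fun _ _ => Finset.sum_congr rfl fun _ _ => by ring
      rw [Finset.sum_congr rfl fun i _ => h1 i, Finset.sum_add_distrib, Finset.sum_add_distrib,
        ← Finset.sum_mul, hf, ← Finset.mul_sum]
      simp
    rw [h, mul_add, mul_left_comm, ih]
    push_cast
    ring

theorem attn_apply {d : ℕ} (q : Fin d → ℝ) (K V : Matrix ι (Fin d) ℝ) (j : Fin d) :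
    attn q K V j = (∑ i, Real.exp (K.mulVec q i) * V i j) / ∑ i, Real.exp (K.mulVec q i) := by
  simp only [attn, Matrix.mulVec, dotProduct, Matrix.transpose_apply, softmax]
  rw [Finset.sum_div]
  exact Finset.sum_congr rfl fun i _ => by ring

theorem sum_exp_mul_sub_attn [Nonempty ι] {d : ℕ} (q : Fin d → ℝ) (K V : Matrix ι (Fin d) ℝ)
    (j : Fin d) : ∑ i, Real.exp (K.mulVec q i) * (V i j - attn q K V j) = 0 := by
  have hpos : 0 < ∑ i, Real.exp (K.mulVec q i) :=
    Finset.sum_pos (fun _ _ => Real.exp_pos _) Finset.univ_nonempty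
  simp only [mul_sub, Finset.sum_sub_distrib, ← Finset.sum_mul, attn_apply]
  field_simp
  ring

/-- Chebyshev's inequality. In `400 * d * exp (4ρ)`, 100 is the inverse failure probability, `4 * d`
bounds the centred values, and `exp (2ρ)` enters once from the weights and once from the
denominator. -/
theorem card_bad_samples_le [Nonempty ι] {d m : ℕ} (hd : 1 ≤ d) (hm : 0 < m) (q : Fin d → ℝ)
    (K V : Matrix ι (Fin d) ℝ) (ρ ε : ℝ) (hε : 0 ≤ ε) (hρ : ∀ i, |K.mulVec q i| ≤ ρ)
    (hmε : 400 * d * Real.exp (4 * ρ) ≤ m * ε ^ 2) (B : Finset (Fin m → ι))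
    (hB : ∀ τ ∈ B, ε * l2 (softmax (K.mulVec q)) * specNorm V <
      l2 (sampleAttn q (fun s => K (τ s)) (fun s => V (τ s)) - attn q K V)) :
    100 * (B.card : ℝ) ≤ (Fintype.card ι : ℝ) ^ m := by
  set N : ℝ := ((Fintype.card ι : ℕ) : ℝ) with hN
  set T := attn q K V with hT
  set W := l2 (softmax (K.mulVec q)) with hW
  set b := ε * W * specNorm V with hb
  have hN0 : 0 < N := by rw [hN]; exact_mod_cast Fintype.card_pos
  have hm' : (0 : ℝ) < m := by exact_mod_cast hm
  have hb0 : 0 ≤ b := mul_nonneg (mul_nonneg hε (l2_nonneg _)) (specNorm_nonneg _)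
  have hdev : ∑ i, ∑ j, (V i j - T j) ^ 2 ≤ N * (4 * d * (W * specNorm V) ^ 2) := by
    have h1 : ∑ i, ∑ j, (V i j - T j) ^ 2 ≤ ∑ i, ∑ j, (2 * V i j ^ 2 + 2 * T j ^ 2) :=
      Finset.sum_le_sum fun i _ => Finset.sum_le_sum fun j _ => by nlinarith [sq_nonneg (V i j + T j)]
    have h2 : ∑ i, ∑ j, (2 * V i j ^ 2 + 2 * T j ^ 2) =
        2 * ∑ i, ∑ j, V i j ^ 2 + N * (2 * l2 T ^ 2) := by
      simp only [Finset.sum_add_distrib, ← Finset.mul_sum, l2_sq]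
      simp only [Finset.sum_const, Finset.card_univ, nsmul_eq_mul]
      ring
    have h3 := sum_sq_le_card_mul_specNorm_sq V
    have h4 : l2 T ^ 2 ≤ (W * specNorm V) ^ 2 :=
      pow_le_pow_left₀ (l2_nonneg _) (l2_attn_le q K V) 2
    have h5 : 1 ≤ N * W ^ 2 := one_le_card_mul_l2_softmax_sq _
    have hd' : (1 : ℝ) ≤ d := by exact_mod_cast hd
    rw [Fintype.card_fin] at h3
    have h6 : d * specNorm V ^ 2 ≤ N * (d * (W * specNorm V) ^ 2) := by
      have : d * specNorm V ^ 2 * 1 ≤ d * specNorm V ^ 2 * (N * W ^ 2) :=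
        mul_le_mul_of_nonneg_left h5 (by positivity)
      calc _ = _ := (mul_one _).symm
        _ ≤ _ := this
        _ = _ := by ring
    have h7 : N * l2 T ^ 2 ≤ N * (d * (W * specNorm V) ^ 2) := by
      refine mul_le_mul_of_nonneg_left (h4.trans ?_) hN0.le
      exact le_mul_of_one_le_left (sq_nonneg _) hd'
    linarith
  have hy : ∑ j, ∑ i, (Real.exp (K.mulVec q i) * (V i j - T j)) ^ 2 ≤
      Real.exp (2 * ρ) * (N * (4 * d * (W * specNorm V) ^ 2)) := by
    refine le_trans ?_ (mul_le_mul_of_nonneg_left hdev (Real.exp_pos _).le)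
    rw [Finset.sum_comm, Finset.mul_sum]
    refine Finset.sum_le_sum fun i _ => ?_
    rw [Finset.mul_sum]
    refine Finset.sum_le_sum fun j _ => ?_
    rw [mul_pow, ← Real.exp_nat_mul]
    refine mul_le_mul_of_nonneg_right (Real.exp_le_exp.2 ?_) (sq_nonneg _)
    push_cast
    linarith [(abs_le.1 (hρ i)).2]
  have hmom : ∑ τ : Fin m → ι,
      l2 (sampleAttn q (fun s => K (τ s)) (fun s => V (τ s)) - T) ^ 2 ≤ N ^ m * (b ^ 2 / 100) := by
    have h1 : N * ∑ τ : Fin m → ι, ∑ j,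
        (∑ s, Real.exp (K.mulVec q (τ s)) * (V (τ s) j - T j)) ^ 2 =
        m * N ^ m * ∑ j, ∑ i, (Real.exp (K.mulVec q i) * (V i j - T j)) ^ 2 := by
      rw [Finset.sum_comm, Finset.mul_sum, Finset.mul_sum]
      exact Finset.sum_congr rfl fun j _ =>
        sum_sq_sum_sample (fun i => Real.exp (K.mulVec q i) * (V i j - T j))
          (sum_exp_mul_sub_attn q K V j) m
    have h2 : ∑ τ : Fin m → ι, ∑ j,
        (∑ s, Real.exp (K.mulVec q (τ s)) * (V (τ s) j - T j)) ^ 2 ≤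
        m * N ^ m * (Real.exp (2 * ρ) * (4 * d * (W * specNorm V) ^ 2)) := by
      refine le_of_mul_le_mul_left ?_ hN0
      rw [h1]
      calc _ ≤ m * N ^ m * (Real.exp (2 * ρ) * (N * (4 * d * (W * specNorm V) ^ 2))) :=
            mul_le_mul_of_nonneg_left hy (by positivity)
        _ = _ := by ring
    have hE : Real.exp (4 * ρ) = Real.exp (2 * ρ) * Real.exp (2 * ρ) := by
      rw [← Real.exp_add]; congr 1; ring
    calc _ ≤ ∑ τ : Fin m → ι, Real.exp (2 * ρ) / m ^ 2 * ∑ j,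
          (∑ s, Real.exp (K.mulVec q (τ s)) * (V (τ s) j - T j)) ^ 2 :=
          Finset.sum_le_sum fun τ _ => l2_sampleAttn_sub_sq_le hm q K V ρ hρ T τ
      _ ≤ Real.exp (2 * ρ) / m ^ 2 *
          (m * N ^ m * (Real.exp (2 * ρ) * (4 * d * (W * specNorm V) ^ 2))) := by
          rw [← Finset.mul_sum]
          exact mul_le_mul_of_nonneg_left h2 (by positivity)
      _ = N ^ m * (400 * d * Real.exp (4 * ρ) * ((W * specNorm V) ^ 2 / (100 * m))) := by
          rw [hE]; field_simp; ring
      _ ≤ N ^ m * (m * ε ^ 2 * ((W * specNorm V) ^ 2 / (100 * m))) :=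
          mul_le_mul_of_nonneg_left (mul_le_mul_of_nonneg_right hmε (by positivity))
            (by positivity)
      _ = _ := by rw [hb]; field_simp
  by_contra hcon
  push Not at hcon
  have hne : B.Nonempty := by
    rw [Finset.nonempty_iff_ne_empty]
    rintro rfl
    simp only [Finset.card_empty, Nat.cast_zero, mul_zero] at hcon
    exact absurd hcon (not_lt.2 (by positivity))
  -- Strictness matters: the threshold `b` may be zero, and then this already reads `0 < 0`.
  have hlt : (B.card : ℝ) * b ^ 2 < N ^ m * (b ^ 2 / 100) := by
    calc (B.card : ℝ) * b ^ 2 = ∑ _τ ∈ B, b ^ 2 := by simp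
      _ < ∑ τ ∈ B, l2 (sampleAttn q (fun s => K (τ s)) (fun s => V (τ s)) - T) ^ 2 :=
          Finset.sum_lt_sum_of_nonempty hne fun τ hτ =>
            pow_lt_pow_left₀ (hB τ hτ) hb0 two_ne_zero
      _ ≤ _ := Finset.sum_le_univ_sum_of_nonneg fun _ => sq_nonneg _
      _ ≤ _ := hmom
  nlinarith [sq_nonneg b]

end Sampling

/-! ### Finite-state machines as streaming algorithms -/

section Machines

variable {α β : Type}

/-- All coins are tossed at the start; afterwards the run is deterministic, so the output law is a
push-forward of the initial law. -/
theorem exists_alg_of_machine {Q : Type} [Fintype Q] [Nonempty Q] {S : ℕ}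
    (hS : Fintype.card Q ≤ 2 ^ S) (μ : PMF Q) (step : Q → α → Q) (out : Q → β) :
    ∃ alg : StreamAlg S α β, ∀ (l : List α) (E : Set β),
      alg.prob l E = μ.toOuterMeasure {s | out (l.foldl step s) ∈ E} := by
  obtain ⟨e⟩ : Nonempty (Q ↪ (Fin S → Bool)) :=
    Function.Embedding.nonempty_of_card_le (by simpa using hS)
  have hinv : Function.LeftInverse (Function.invFun e) e :=
    Function.leftInverse_invFun e.injective
  let alg : StreamAlg S α β :=
    { init := μ.map e
      update := fun m x => PMF.pure (e (step (Function.invFun e m) x))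
      output := fun m => PMF.pure (out (Function.invFun e m)) }
  have hmem : ∀ l : List α, alg.memory l = μ.map fun s => e (l.foldl step s) := by
    intro l
    induction l using List.reverseRecOn with
    | nil => rfl
    | append_singleton l x ih =>
      have h1 : alg.memory (l ++ [x]) = (alg.memory l).bind fun m => alg.update m x := by
        simp [StreamAlg.memory]
      rw [h1, ih, PMF.bind_map, ← PMF.bind_pure_comp]
      congr 1
      funext s
      simp [alg, hinv _]
  refine ⟨alg, fun l E => ?_⟩
  have h2 : (alg.memory l).bind alg.output = μ.map fun s => out (l.foldl step s) := by
    rw [hmem, PMF.bind_map, ← PMF.bind_pure_comp]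
    congr 1
    funext s
    simp [alg, hinv _]
  rw [StreamAlg.prob, h2, PMF.toOuterMeasure_map_apply]
  rfl

/-- The state holds a counter, the `m` positions drawn in advance, the items collected there, and
the latest item, which at the end carries the query to be answered. This gives `m + 1` items in the
state count. -/
theorem exists_sampling_alg (T : Finset α) (hT : T.Nonempty) {N m S : ℕ} (hN : 0 < N)
    (hS : (N + 1) * N ^ m * T.card ^ (m + 1) ≤ 2 ^ S) (out : (Fin m → α) → α → β) :
    ∃ alg : StreamAlg S α β, ∀ f : Fin N → α, (∀ t, f t ∈ T) → ∀ E : Set β,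
      alg.prob (List.ofFn f) E * (N : ℝ≥0∞) ^ m =
        ({τ : Fin m → Fin N | out (fun s => f (τ s)) (f ⟨N - 1, Nat.sub_lt hN Nat.one_pos⟩) ∈ E}.ncard
          : ℝ≥0∞) := by
  classical
  have : NeZero N := ⟨hN.ne'⟩
  obtain ⟨t₀, ht₀⟩ := hT
  let x₀ : T := ⟨t₀, ht₀⟩
  -- Truncating to `T` keeps the state space finite; `x₀` also fills the slots whose position has
  -- not been reached.
  let proj : α → T := fun x => if h : x ∈ T then ⟨x, h⟩ else x₀
  let Q : Type := Fin (N + 1) × (Fin m → Fin N) × (Fin m → T) × T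
  let step : Q → α → Q := fun s x =>
    (s.1 + 1, s.2.1, fun k => if (s.2.1 k : ℕ) = s.1 then proj x else s.2.2.1 k, proj x)
  let start : (Fin m → Fin N) → Q := fun τ => (0, τ, fun _ => x₀, x₀)
  have hcard : Fintype.card Q ≤ 2 ^ S := by
    have : Fintype.card Q = (N + 1) * N ^ m * T.card ^ (m + 1) := by
      simp [Q]; ring
    rw [this]; exact hS
  have : Nonempty Q := ⟨start fun _ => 0⟩
  obtain ⟨alg, halg⟩ := exists_alg_of_machine hcard
    ((PMF.uniformOfFintype (Fin m → Fin N)).map start) step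
    (fun s => out (fun k => (s.2.2.1 k : α)) s.2.2.2)
  -- Closed form of the state after a prefix. The counter has `N + 1` values, so it does not wrap
  -- around within `N` items.
  have hfold : ∀ (l : List α) (τ : Fin m → Fin N), l.length ≤ N →
      l.foldl step (start τ) = (Fin.ofNat (N + 1) l.length, τ,
        fun k => (l.map proj).getD (τ k) x₀, (l.map proj).getLastD x₀) := by
    intro l τ
    induction l using List.reverseRecOn with
    | nil => intro _; simp [start]
    | append_singleton l x ih =>
      intro hl
      rw [List.length_append, List.length_singleton] at hl
      rw [List.foldl_append, ih (by omega)]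
      have hv : (Fin.ofNat (N + 1) l.length : ℕ) = l.length := by
        rw [Fin.val_ofNat, Nat.mod_eq_of_lt (by omega)]
      simp only [List.foldl_cons, List.foldl_nil, step, hv, List.length_append,
        List.length_singleton, List.map_append, List.map_cons, List.map_nil, List.getLastD_concat]
      refine Prod.ext (Fin.ext (by
        rw [Fin.val_add, hv, Fin.val_ofNat, Fin.val_one', Nat.add_mod_mod])) (Prod.ext rfl (Prod.ext ?_ rfl))
      funext k
      simp only [List.getD_eq_getElem?_getD, List.getElem?_append, List.length_map]
      rcases lt_trichotomy (τ k : ℕ) l.length with h | h | h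
      · simp [h, h.ne]
      · simp [h]
      · rw [if_neg h.ne', if_neg h.not_gt]
        simp [h.le, Nat.sub_ne_zero_of_lt h, -List.getElem?_map]
  refine ⟨alg, fun f hf E => ?_⟩
  have hfin : ∀ τ : Fin m → Fin N, (List.ofFn f).foldl step (start τ) =
      (Fin.ofNat (N + 1) N, τ, fun k => ⟨f (τ k), hf _⟩,
        ⟨f ⟨N - 1, Nat.sub_lt hN Nat.one_pos⟩, hf _⟩) := by
    intro τ
    rw [hfold _ _ (by simp), List.length_ofFn]
    refine Prod.ext rfl (Prod.ext rfl (Prod.ext ?_ ?_))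
    · funext k
      simp [List.getD_eq_getElem?_getD, proj, hf]
    · rw [List.getLastD_eq_getLast?, List.getLast?_eq_getElem?]
      simp [proj, hf, hN]
  rw [halg, PMF.toOuterMeasure_map_apply, PMF.toOuterMeasure_uniformOfFintype_apply]
  have hset : (start ⁻¹' {s | out (fun k => (((List.ofFn f).foldl step s).2.2.1 k : α))
      ((List.ofFn f).foldl step s).2.2.2 ∈ E}) =
      {τ : Fin m → Fin N | out (fun s => f (τ s)) (f ⟨N - 1, Nat.sub_lt hN Nat.one_pos⟩) ∈ E} := by
    ext τ
    simp only [Set.mem_preimage, Set.mem_ofPred_eq, hfin]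
  rw [← Nat.card_eq_fintype_card, Nat.card_coe_set_eq, hset]
  have hN' : ((N : ℝ≥0∞) ^ m) ≠ 0 := pow_ne_zero _ (by exact_mod_cast hN.ne')
  have hN'' : ((N : ℝ≥0∞) ^ m) ≠ ∞ := ENNReal.pow_ne_top (ENNReal.natCast_ne_top N)
  simp only [Fintype.card_fun, Fintype.card_fin, Nat.cast_pow]
  exact ENNReal.div_mul_cancel hN' hN''

end Machines

/-! ### The SubGen2Cache algorithm and its space -/

theorem exists_zero_output_alg {n d : ℕ} (r ε : ℝ) (hε : 1 ≤ ε) (A : Set ℝ) :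
    ∃ alg : CacheAlg 0 d, alg.Approximates n r ε A := by
  obtain ⟨alg, halg⟩ := exists_alg_of_machine (α := (Fin d → ℝ) × (Fin d → ℝ) × (Fin d → ℝ))
    (S := 0) (by simp) (PMF.pure ()) (fun s _ => s) (fun _ => (0 : Fin d → ℝ))
  refine ⟨alg, fun X _ _ _ σ => ?_⟩
  have h : l2 (0 - X.target) ≤ ε * l2 X.weights * specNorm X.values := by
    have h1 : l2 (0 - X.target) = l2 X.target := by simp [l2]
    rw [h1, mul_assoc]
    exact (l2_attn_le _ _ _).trans (le_mul_of_one_le_left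
      (mul_nonneg (l2_nonneg _) (specNorm_nonneg _)) hε)
  rw [halg]
  simp only [Set.mem_ofPred_eq, h, PMF.toOuterMeasure_pure_apply, if_true]
  exact ENNReal.div_le_of_le_mul (by norm_num)

/-- The stream shows products of two numbers of the format, not the numbers themselves. The exponent
`3 * w` comes from `1 + 2^w + 4^w ≤ 8^w`. -/
theorem exists_finset_products (A : Finset ℝ) {w : ℕ} (hw : 1 ≤ w) (hA : A.card ≤ 2 ^ w) :
    ∃ B : Finset ℝ, B.Nonempty ∧ B.card ≤ 2 ^ (3 * w) ∧ A ⊆ B ∧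
      ∀ x ∈ A, ∀ y ∈ A, x * y ∈ B := by
  classical
  refine ⟨insert 0 (A ∪ Finset.image₂ (· * ·) A A), Finset.insert_nonempty _ _, ?_,
    fun x hx => by simp [hx], fun x hx y hy =>
      Finset.mem_insert_of_mem (Finset.mem_union_right _ (Finset.mem_image₂_of_mem hx hy))⟩
  have h1 : (Finset.image₂ (· * ·) A A).card ≤ 2 ^ w * 2 ^ w :=
    (Finset.card_image₂_le _ _ _).trans (Nat.mul_le_mul hA hA)
  have h2 := Finset.card_insert_le (0 : ℝ) (A ∪ Finset.image₂ (· * ·) A A)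
  have h3 := Finset.card_union_le A (Finset.image₂ (· * ·) A A)
  have h4 : 2 ≤ 2 ^ w := by simpa using Nat.pow_le_pow_right (n := 2) (by norm_num) hw
  have h5 : 2 ^ (3 * w) = 2 ^ w * 2 ^ w * 2 ^ w := by rw [← pow_add, ← pow_add]; congr 1; ring
  rw [h5]
  nlinarith [Nat.mul_le_mul h4 (le_refl (2 ^ w * 2 ^ w)), Nat.mul_le_mul h4 (le_refl (2 ^ w))]

theorem Input.abs_keys_mulVec_le {n d : ℕ} (X : Input n d) (hX : X.KeysBounded) (q : Fin d → ℝ)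
    (p : Fin n × Fin n) : |X.keys.mulVec q p| ≤ l2 q :=
  abs_colKron_mulVec_le _ _ (fun i => (hX i).1) (fun i => (hX i).2) q p

/-- The counter and each sampled position cost `2 * (log n + 1)` bits; each stored triple has `3 *
d` entries of `3 * w` bits. -/
theorem exists_approximating_alg {n d m w S : ℕ} (hn : 0 < n) (hd : 1 ≤ d) (hm : 0 < m)
    (hw : 1 ≤ w) (r ε : ℝ) (hε : 0 ≤ ε) (hmε : 400 * d * Real.exp (4 * r) ≤ m * ε ^ 2)
    (A : Finset ℝ) (hA : A.card ≤ 2 ^ w)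
    (hS : (m + 1) * (2 * (Nat.log 2 n + 1) + 9 * w * d) ≤ S) :
    ∃ alg : CacheAlg S d, alg.Approximates n r ε (A : Set ℝ) := by
  classical
  obtain ⟨B, hB, hBc, hAB, hABm⟩ := exists_finset_products A hw hA
  let P : Finset (Fin d → ℝ) := Fintype.piFinset fun _ => B
  have hP : P.Nonempty := Fintype.piFinset_nonempty.2 fun _ => hB
  have hPc : P.card ≤ 2 ^ (3 * w * d) := by
    simp only [P, Fintype.card_piFinset_const]
    rw [pow_mul]
    exact Nat.pow_le_pow_left hBc d
  have hTc : (P ×ˢ P ×ˢ P).card ≤ 2 ^ (9 * w * d) := by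
    rw [Finset.card_product, Finset.card_product]
    calc _ ≤ 2 ^ (3 * w * d) * (2 ^ (3 * w * d) * 2 ^ (3 * w * d)) :=
          Nat.mul_le_mul hPc (Nat.mul_le_mul hPc hPc)
      _ = _ := by rw [← pow_add, ← pow_add]; congr 1; ring
  have hN : 0 < n * n := Nat.mul_pos hn hn
  have hNle : n * n + 1 ≤ 2 ^ (2 * (Nat.log 2 n + 1)) := by
    have h1 : n + 1 ≤ 2 ^ (Nat.log 2 n + 1) := Nat.lt_pow_succ_log_self (by norm_num) n
    calc n * n + 1 ≤ (n + 1) * (n + 1) := by nlinarith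
      _ ≤ _ := Nat.mul_le_mul h1 h1
      _ = _ := by rw [← pow_add]; congr 1; ring
  have hcard : (n * n + 1) * (n * n) ^ m * (P ×ˢ P ×ˢ P).card ^ (m + 1) ≤ 2 ^ S := by
    calc _ ≤ (2 ^ (2 * (Nat.log 2 n + 1))) * (2 ^ (2 * (Nat.log 2 n + 1))) ^ m *
          (2 ^ (9 * w * d)) ^ (m + 1) := by
          gcongr
          omega
      _ = 2 ^ ((m + 1) * (2 * (Nat.log 2 n + 1) + 9 * w * d)) := by
          rw [← pow_mul, ← pow_mul, ← pow_add, ← pow_add]; congr 1; ring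
      _ ≤ 2 ^ S := Nat.pow_le_pow_right (by norm_num) hS
  obtain ⟨alg, halg⟩ := exists_sampling_alg (P ×ˢ P ×ˢ P) (hP.product (hP.product hP)) hN hcard
    (fun s (l : (Fin d → ℝ) × (Fin d → ℝ) × (Fin d → ℝ)) =>
      sampleAttn l.1 (fun k => (s k).2.1) (fun k => (s k).2.2))
  refine ⟨alg, fun X hXA hXK hXq σ => ?_⟩
  have hmem : ∀ t, (X.q t, X.keys (σ t), X.values (σ t)) ∈ P ×ˢ P ×ˢ P := by
    intro t
    simp only [Finset.mem_product, P, Fintype.mem_piFinset]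
    exact ⟨fun j => hAB (hXA.1 t j), fun j => hABm _ (hXA.2 _ j).1 _ (hXA.2 _ j).2.1,
      fun j => hABm _ (hXA.2 _ j).2.2.1 _ (hXA.2 _ j).2.2.2⟩
  have hp := halg _ hmem {o | l2 (o - X.target) ≤ ε * l2 X.weights * specNorm X.values}
  have hlast : X.lastQuery = X.q ⟨n * n - 1, Nat.sub_lt hN Nat.one_pos⟩ := by
    rw [Input.lastQuery, dif_pos hN]
  rw [← hlast] at hp
  set good : Finset (Fin m → Fin n × Fin n) := Finset.univ.filter fun τ =>
    l2 (sampleAttn X.lastQuery (fun k => X.keys (τ k)) (fun k => X.values (τ k)) - X.target) ≤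
      ε * l2 X.weights * specNorm X.values with hgood
  have hncard : ({τ : Fin m → Fin (n * n) | sampleAttn X.lastQuery (fun k => X.keys (σ (τ k)))
      (fun k => X.values (σ (τ k))) ∈
      {o | l2 (o - X.target) ≤ ε * l2 X.weights * specNorm X.values}}).ncard = good.card := by
    rw [← Set.ncard_coe_finset good]
    refine Set.ncard_congr (fun τ _ k => σ (τ k)) ?_ ?_ ?_
    · intro τ hτ
      simpa [hgood] using hτ
    · intro τ τ' _ _ h
      funext k
      exact σ.injective (congrFun h k)
    · intro τ hτ
      refine ⟨fun k => σ.symm (τ k), ?_, by simp⟩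
      simpa [hgood] using hτ
  have : Nonempty (Fin n × Fin n) := ⟨(⟨0, hn⟩, ⟨0, hn⟩)⟩
  have hbad := card_bad_samples_le hd hm X.lastQuery X.keys X.values r ε hε
    (fun p => (X.abs_keys_mulVec_le hXK _ p).trans (hlast ▸ hXq _)) hmε goodᶜ (by
      intro τ hτ
      rw [hgood, Finset.mem_compl, Finset.mem_filter] at hτ
      exact not_le.1 fun h => hτ ⟨Finset.mem_univ _, h⟩)
  have hsum : goodᶜ.card + good.card = (n * n) ^ m := by
    rw [Finset.card_compl_add_card]; simp
  have hgoodc : 99 * (n * n) ^ m ≤ 100 * good.card := by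
    have hbad' : 100 * goodᶜ.card ≤ (n * n) ^ m := by
      have : ((100 * goodᶜ.card : ℕ) : ℝ) ≤ (((n * n) ^ m : ℕ) : ℝ) := by
        push_cast at hbad ⊢
        simpa using hbad
      exact_mod_cast this
    omega
  have hfin : (99 / 100 : ℝ≥0∞) * ((n * n : ℕ) : ℝ≥0∞) ^ m ≤
      alg.prob (X.stream σ) {o | l2 (o - X.target) ≤ ε * l2 X.weights * specNorm X.values} *
        ((n * n : ℕ) : ℝ≥0∞) ^ m := by
    have hp' : alg.prob (X.stream σ)
        {o | l2 (o - X.target) ≤ ε * l2 X.weights * specNorm X.values} *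
        ((n * n : ℕ) : ℝ≥0∞) ^ m = (good.card : ℝ≥0∞) := by
      rw [← hncard]; exact hp
    rw [hp', ENNReal.mul_div_right_comm.symm]
    refine ENNReal.div_le_of_le_mul ?_
    rw [mul_comm (good.card : ℝ≥0∞)]
    exact_mod_cast hgoodc
  exact (ENNReal.mul_le_mul_iff_left (pow_ne_zero _ (by exact_mod_cast hN.ne'))
    (ENNReal.pow_ne_top (ENNReal.natCast_ne_top _))).1 hfin

theorem log_two_nat_le (n : ℕ) : (Nat.log 2 n : ℝ) ≤ 2 * Real.log n := by
  rcases Nat.eq_zero_or_pos n with rfl | hn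
  · simp
  have h : ((2 ^ Nat.log 2 n : ℕ) : ℝ) ≤ n := by exact_mod_cast Nat.pow_log_le_self 2 hn.ne'
  have h1 := Real.log_le_log (by positivity) h
  push_cast at h1
  rw [Real.log_pow] at h1
  have h2 : (1 / 2 : ℝ) ≤ Real.log 2 := by linarith [Real.log_two_gt_d9]
  have : (0 : ℝ) ≤ Nat.log 2 n := Nat.cast_nonneg _
  nlinarith

theorem subGen2Cache_space (c : ℝ) : ∃ (C : ℝ) (κ : ℕ), ∀ (d : ℕ → ℕ) (r : ℕ → ℝ),
    (∀ n, 2 ≤ d n) →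
    (fun n => (d n : ℝ)) =o[atTop] (fun n : ℕ => Real.log n) →
    IsBigOWith c atTop r (fun n : ℕ => Real.log (Real.log n)) →
    ∀ᶠ n : ℕ in atTop, ∀ ε : ℝ, 0 < ε → ∀ w : ℕ, 1 ≤ w →
      ∀ A : Finset ℝ, A.card ≤ 2 ^ w →
        ∃ S : ℕ,
          (S : ℝ) ≤ C * w * (ε ^ 2)⁻¹ * (d n * Real.exp (d n)) * Real.log n ^ κ ∧
          ∃ alg : CacheAlg S (d n), alg.Approximates n (r n) ε (A : Set ℝ) := by
  -- `6030 = 402 * 15`: sample count times bits per sample. The power `⌈4|c|⌉` of the logarithm pays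
  -- for `exp (4r)`, the extra one for the bits per sample.
  refine ⟨6030, ⌈4 * |c|⌉₊ + 1, fun d r hd hdo hr => ?_⟩
  have hlog : Tendsto (fun n : ℕ => Real.log n) atTop atTop :=
    Real.tendsto_log_atTop.comp tendsto_natCast_atTop_atTop
  filter_upwards [hdo.bound one_pos, hr.bound, hlog.eventually_ge_atTop 1,
    eventually_gt_atTop 0] with n hdn hrn hL hn ε hε w hw A hA
  rw [Real.norm_of_nonneg (Nat.cast_nonneg _), one_mul, Real.norm_of_nonneg (by linarith)] at hdn
  have hLL : 0 ≤ Real.log (Real.log n) := Real.log_nonneg hL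
  rw [Real.norm_of_nonneg hLL, Real.norm_eq_abs] at hrn
  set L := Real.log n with hLdef
  have hL0 : 0 < L := by linarith
  have hd2 : (2 : ℝ) ≤ d n := by exact_mod_cast hd n
  have hw1 : (1 : ℝ) ≤ w := by exact_mod_cast hw
  -- For large `ε` the allowed space may be less than one bit, so this case uses the constant output
  -- 0 and no memory.
  by_cases hε1 : 1 ≤ ε
  · refine ⟨0, ?_, exists_zero_output_alg _ _ hε1 _⟩
    simp only [Nat.cast_zero]
    positivity
  push Not at hε1
  have hexp : Real.exp (4 * r n) ≤ L ^ ⌈4 * |c|⌉₊ := by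
    have h1 : 4 * r n ≤ (⌈4 * |c|⌉₊ : ℝ) * Real.log L := by
      calc 4 * r n ≤ 4 * |r n| := by linarith [le_abs_self (r n)]
        _ ≤ 4 * (|c| * Real.log L) := by
            have := mul_le_mul_of_nonneg_right (le_abs_self c) hLL
            linarith
        _ = 4 * |c| * Real.log L := by ring
        _ ≤ _ := mul_le_mul_of_nonneg_right (Nat.le_ceil _) hLL
    calc Real.exp (4 * r n) ≤ Real.exp ((⌈4 * |c|⌉₊ : ℝ) * Real.log L) := Real.exp_le_exp.2 h1
      _ = L ^ ⌈4 * |c|⌉₊ := by rw [Real.exp_nat_mul, Real.exp_log hL0]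
  set R := L ^ ⌈4 * |c|⌉₊ with hR
  have hR1 : 1 ≤ R := one_le_pow₀ hL
  set x := 400 * d n * R * (ε ^ 2)⁻¹ with hx
  have hε2 : 1 ≤ (ε ^ 2)⁻¹ := (one_le_inv₀ (by positivity)).2 (pow_le_one₀ hε.le hε1.le)
  have hx0 : 0 < x := by positivity
  have hdR : 2 ≤ d n * R * (ε ^ 2)⁻¹ := by
    have h1 : 2 ≤ d n * R := by nlinarith
    nlinarith
  refine ⟨(⌈x⌉₊ + 1) * (2 * (Nat.log 2 n + 1) + 9 * w * d n), ?_,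
    exists_approximating_alg hn (by have := hd n; omega) (Nat.ceil_pos.2 hx0) hw (r n) ε hε.le
      ?_ A hA le_rfl⟩
  · push_cast
    have h1 : (⌈x⌉₊ : ℝ) + 1 ≤ 402 * (d n * R * (ε ^ 2)⁻¹) := by
      have := Nat.ceil_lt_add_one hx0.le
      have : x = 400 * (d n * R * (ε ^ 2)⁻¹) := by rw [hx]; ring
      linarith
    -- The dimension of the stored vectors is absorbed by `d ≤ log n`; the factor `d` in the final
    -- bound comes from the number of samples.
    have h2 : 2 * ((Nat.log 2 n : ℝ) + 1) + 9 * w * d n ≤ 15 * (w * L) := by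
      have h3 := log_two_nat_le n
      have h4 : w * (d n : ℝ) ≤ w * L := mul_le_mul_of_nonneg_left hdn (by linarith)
      have h5 : L ≤ w * L := le_mul_of_one_le_left hL0.le hw1
      linarith
    have h6 : (1 : ℝ) ≤ Real.exp (d n) := Real.one_le_exp (by linarith)
    calc _ ≤ 402 * (d n * R * (ε ^ 2)⁻¹) * (15 * (w * L)) :=
          mul_le_mul h1 h2 (by positivity) (by positivity)
      _ = 6030 * w * (ε ^ 2)⁻¹ * (d n * 1) * (L ^ ⌈4 * |c|⌉₊ * L) := by rw [← hR]; ring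
      _ ≤ 6030 * w * (ε ^ 2)⁻¹ * (d n * Real.exp (d n)) * (L ^ ⌈4 * |c|⌉₊ * L) := by
          gcongr
      _ = _ := by rw [pow_succ L]
  · have h1 : x * ε ^ 2 = 400 * d n * R := by rw [hx]; field_simp
    calc 400 * d n * Real.exp (4 * r n) ≤ 400 * d n * R := by gcongr
      _ = x * ε ^ 2 := h1.symm
      _ ≤ ⌈x⌉₊ * ε ^ 2 := mul_le_mul_of_nonneg_right (Nat.le_ceil x) (sq_nonneg _)

/-! ### The one-way INDEX bound -/

section Index

theorem exp_mul_le_one_add {t g : ℝ} (h0 : 0 ≤ g) (h1 : g ≤ 1) :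
    Real.exp (t * g) ≤ 1 + g * (Real.exp t - 1) := by
  have h := convexOn_exp.2 (Set.mem_univ (0 : ℝ)) (Set.mem_univ t) (sub_nonneg.2 h1) h0
    (by ring)
  simp only [smul_eq_mul, mul_zero, zero_add, Real.exp_zero, mul_one] at h
  rw [mul_comm t]
  linarith

/-- Let `G m x` be the exponential of `t = log Q` times the total probability that message `m`
assigns to the symbols of `x`. Averaged over a uniform `x`, it is at most `2 ^ N` for each fixed
`m`, since the coordinates are independent. Averaged over the message sent for `x`, it is at least
`exp (9/10 * N * t)` by Jensen. The gap must be covered by the number of messages. -/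
theorem index_weights_bound {ι α M : Type*} [Fintype ι] [DecidableEq ι] [Fintype α] [Nonempty α]
    [Fintype M] (μ : (ι → α) → M → ℝ) (hμ0 : ∀ x m, 0 ≤ μ x m) (hμ1 : ∀ x, ∑ m, μ x m = 1)
    (g : M → ι → α → ℝ) (hg0 : ∀ m i y, 0 ≤ g m i y) (hg1 : ∀ m i, ∑ y, g m i y ≤ 1)
    (h : ∀ x i, 9 / 10 ≤ ∑ m, μ x m * g m i (x i)) :
    Real.exp (9 / 10 * Fintype.card ι * Real.log (Fintype.card α)) ≤
      Fintype.card M * 2 ^ Fintype.card ι := by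
  set Q : ℝ := ((Fintype.card α : ℕ) : ℝ) with hQ
  set N : ℝ := ((Fintype.card ι : ℕ) : ℝ) with hN
  have hQ1 : 1 ≤ Q := by rw [hQ]; exact_mod_cast Fintype.card_pos
  have hQ0 : 0 < Q := by linarith
  set t := Real.log Q with ht
  have ht0 : 0 ≤ t := Real.log_nonneg hQ1
  set a := 9 / 10 * N * t with ha
  let G : M → (ι → α) → ℝ := fun m x => Real.exp (t * ∑ i, g m i (x i))
  have hlow : ∀ x, Real.exp a ≤ ∑ m, μ x m * G m x := by
    intro x
    -- Jensen by hand: the tangent line of `exp` at `a` lies below it.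
    have h1 : ∀ m ∈ Finset.univ, μ x m * (Real.exp a * (1 - a) + Real.exp a *
        (t * ∑ i, g m i (x i))) ≤ μ x m * G m x := by
      intro m _
      refine mul_le_mul_of_nonneg_left ?_ (hμ0 x m)
      have h2 := Real.add_one_le_exp (t * ∑ i, g m i (x i) - a)
      have h3 : G m x = Real.exp a * Real.exp (t * ∑ i, g m i (x i) - a) := by
        rw [← Real.exp_add]; simp only [G]; congr 1; ring
      rw [h3]
      nlinarith [Real.exp_pos a]
    refine le_trans ?_ (Finset.sum_le_sum h1)
    have h4 : ∑ m, μ x m * (Real.exp a * (1 - a) + Real.exp a * (t * ∑ i, g m i (x i))) =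
        Real.exp a * (1 - a) + Real.exp a * (t * ∑ i, ∑ m, μ x m * g m i (x i)) := by
      rw [Finset.sum_comm]
      simp only [mul_add, Finset.sum_add_distrib, ← Finset.sum_mul, hμ1, one_mul,
        ← Finset.mul_sum]
      congr 1
      rw [Finset.mul_sum, Finset.mul_sum]
      exact Finset.sum_congr rfl fun m _ => by ring
    have h5 : 9 / 10 * N ≤ ∑ i, ∑ m, μ x m * g m i (x i) := by
      calc 9 / 10 * N = ∑ _i : ι, (9 / 10 : ℝ) := by simp [hN, mul_comm]
        _ ≤ _ := Finset.sum_le_sum fun i _ => h x i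
    rw [h4]
    have h6 : a ≤ t * ∑ i, ∑ m, μ x m * g m i (x i) := by
      rw [ha, mul_comm]; exact mul_le_mul_of_nonneg_left h5 ht0
    nlinarith [Real.exp_pos a]
  have hup : ∀ m, ∑ x, G m x ≤ (2 * Q) ^ Fintype.card ι := by
    intro m
    have h1 : ∑ x, G m x = ∏ i, ∑ y, Real.exp (t * g m i y) := by
      rw [Finset.prod_univ_sum, Fintype.piFinset_univ]
      refine Finset.sum_congr rfl fun x _ => ?_
      simp only [G]
      rw [← Real.exp_sum, Finset.mul_sum]
    rw [h1]
    calc _ ≤ ∏ _i : ι, 2 * Q := by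
          refine Finset.prod_le_prod (fun i _ => Finset.sum_nonneg fun _ _ => (Real.exp_pos _).le)
            fun i _ => ?_
          have hle : ∀ y, g m i y ≤ 1 := fun y =>
            (Finset.single_le_sum (fun y _ => hg0 m i y) (Finset.mem_univ y)).trans (hg1 m i)
          calc ∑ y, Real.exp (t * g m i y) ≤ ∑ y, (1 + g m i y * (Real.exp t - 1)) :=
                Finset.sum_le_sum fun y _ => exp_mul_le_one_add (hg0 m i y) (hle y)
            _ = Q + (∑ y, g m i y) * (Q - 1) := by
                rw [Finset.sum_add_distrib, ← Finset.sum_mul, ht, Real.exp_log hQ0]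
                simp [hQ]
            _ ≤ 2 * Q := by nlinarith [hg1 m i]
      _ = _ := by simp
  have hmain : Q ^ Fintype.card ι * Real.exp a ≤
      Q ^ Fintype.card ι * (Fintype.card M * 2 ^ Fintype.card ι) := by
    calc Q ^ Fintype.card ι * Real.exp a = ∑ _x : ι → α, Real.exp a := by simp [hQ]
      _ ≤ ∑ x, ∑ m, μ x m * G m x := Finset.sum_le_sum fun x _ => hlow x
      _ ≤ ∑ x, ∑ m, G m x := by
          -- Replacing the probability of each message by 1 is what costs the factor `Fintype.card
          -- M`.
          refine Finset.sum_le_sum fun x _ => Finset.sum_le_sum fun m _ => ?_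
          refine mul_le_of_le_one_left (Real.exp_pos _).le ?_
          rw [← hμ1 x]
          exact Finset.single_le_sum (fun m _ => hμ0 x m) (Finset.mem_univ m)
      _ = ∑ m, ∑ x, G m x := Finset.sum_comm
      _ ≤ ∑ _m : M, (2 * Q) ^ Fintype.card ι := Finset.sum_le_sum fun m _ => hup m
      _ = _ := by simp [mul_pow]; ring
  exact le_of_mul_le_mul_left hmain (by positivity)

theorem StreamAlg.memory_append_singleton {S : ℕ} {α β : Type} (A : StreamAlg S α β) (l : List α)
    (x : α) : A.memory (l ++ [x]) = (A.memory l).bind fun m => A.update m x := by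
  simp [StreamAlg.memory]

/-- One-way communication bound for recovering a symbol chosen by the last item of a stream. -/
theorem StreamAlg.index_bound {S : ℕ} {α β ι γ : Type} [Fintype ι] [Fintype γ] [Nonempty γ]
    (A : StreamAlg S α β) (pre : (ι → γ) → List α) (last : ι → α) (decode : β → γ)
    (h : ∀ x i, (9 / 10 : ℝ≥0∞) ≤ A.prob (pre x ++ [last i]) {o | decode o = x i}) :
    Real.exp (9 / 10 * Fintype.card ι * Real.log (Fintype.card γ)) ≤
      2 ^ S * 2 ^ Fintype.card ι := by
  classical
  have hpmf : ∀ {κ : Type} [Fintype κ] (p : PMF κ), ∑ k, (p k).toReal = 1 := by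
    intro κ _ p
    have h1 := p.tsum_coe
    rw [tsum_fintype] at h1
    rw [← ENNReal.toReal_sum fun k _ => p.apply_ne_top k, h1, ENNReal.toReal_one]
  -- The law of the decoded symbol given the memory before the last item; it depends on `x` only
  -- through that memory.
  let ν : (Fin S → Bool) → ι → PMF γ := fun m i => ((A.update m (last i)).bind A.output).map decode
  have key := index_weights_bound (fun x m => (A.memory (pre x) m).toReal)
    (fun _ _ => ENNReal.toReal_nonneg) (fun x => hpmf _)
    (fun m i y => (ν m i y).toReal) (fun _ _ _ => ENNReal.toReal_nonneg)
    (fun m i => (hpmf _).le) (by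
      intro x i
      have h1 : A.prob (pre x ++ [last i]) {o | decode o = x i} =
          ∑ m, A.memory (pre x) m * ν m i (x i) := by
        rw [StreamAlg.prob, A.memory_append_singleton, PMF.bind_bind,
          PMF.toOuterMeasure_bind_apply, tsum_fintype]
        refine Finset.sum_congr rfl fun m _ => ?_
        rw [← PMF.toOuterMeasure_apply_singleton (ν m i), PMF.toOuterMeasure_map_apply]
        rfl
      have h2 := h x i
      rw [h1] at h2
      have h3 := ENNReal.toReal_mono (ENNReal.sum_ne_top.2 fun m _ =>
        ENNReal.mul_ne_top (PMF.apply_ne_top _ _) (PMF.apply_ne_top _ _)) h2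
      rw [ENNReal.toReal_sum fun m _ =>
        ENNReal.mul_ne_top (PMF.apply_ne_top _ _) (PMF.apply_ne_top _ _)] at h3
      simpa using h3)
  simpa using key

end Index

/-! ### Hard inputs: keys on a parabola -/

section HardInstance

theorem sum_fin_eq_add {d : ℕ} (hd : 2 ≤ d) (f : Fin d → ℝ)
    (hf : ∀ j : Fin d, 2 ≤ (j : ℕ) → f j = 0) :
    ∑ j, f j = f ⟨0, by omega⟩ + f ⟨1, by omega⟩ := by
  obtain ⟨k, rfl⟩ : ∃ k, d = k + 2 := ⟨d - 2, by omega⟩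
  rw [Fin.sum_univ_succ, Fin.sum_univ_succ, Finset.sum_eq_zero, add_zero]
  · rfl
  · intro j _
    exact hf _ (by simp)

/-- The vector `(x, y, 0, …, 0)`. -/
def planeVec (d : ℕ) (x y : ℝ) : Fin d → ℝ :=
  fun j => if (j : ℕ) = 0 then x else if (j : ℕ) = 1 then y else 0

theorem planeVec_mem {d : ℕ} {x y : ℝ} {A : Set ℝ} (hx : x ∈ A) (hy : y ∈ A) (h0 : (0 : ℝ) ∈ A)
    (j : Fin d) : planeVec d x y j ∈ A := by
  unfold planeVec; split_ifs <;> assumption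

theorem l2_planeVec_le_one {d : ℕ} (hd : 2 ≤ d) {x y : ℝ} (h : x ^ 2 + y ^ 2 ≤ 1) :
    l2 (planeVec d x y) ≤ 1 := by
  refine Real.sqrt_le_one.2 ?_
  rw [sum_fin_eq_add hd]
  · simpa [planeVec] using h
  · intro j hj
    simp [planeVec, show (j : ℕ) ≠ 0 by omega, show (j : ℕ) ≠ 1 by omega]

theorem div_mem_fixedPoint {p : ℕ} (k : ℤ) (e : ℕ) (he : e ≤ p) (h : |(k : ℝ) / 2 ^ e| ≤ 2 ^ p) :
    (k : ℝ) / 2 ^ e ∈ fixedPoint p := by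
  refine ⟨⟨k * 2 ^ (p - e), ?_⟩, h⟩
  have : (2 : ℝ) ^ p = 2 ^ e * 2 ^ (p - e) := by rw [← pow_add]; congr 1; omega
  rw [this]; push_cast; field_simp

/-- The abscissa, on a parabola, of the key of row `a`. -/
def abscissa (s a : ℕ) : ℝ := (min a (2 ^ s) : ℕ) / 2 ^ (s + 1)

theorem abscissa_nonneg (s a : ℕ) : 0 ≤ abscissa s a := by unfold abscissa; positivity

theorem abscissa_le_half (s a : ℕ) : abscissa s a ≤ 1 / 2 := by
  have h : ((min a (2 ^ s) : ℕ) : ℝ) ≤ 2 ^ s := by exact_mod_cast min_le_right _ _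
  rw [abscissa, div_le_iff₀ (by positivity), pow_succ]
  linarith

/-- All rows with index at least `2 ^ s` share the abscissa `1/2`, which is still a grid step away
from that of any `a < 2 ^ s`. Hence only `a` needs a bound. -/
theorem inv_le_abs_abscissa_sub {s a b : ℕ} (ha : a < 2 ^ s) (hab : b ≠ a) :
    1 / 2 ^ (s + 1) ≤ |abscissa s b - abscissa s a| := by
  have h : (1 : ℝ) ≤ |((min b (2 ^ s) : ℕ) : ℝ) - (min a (2 ^ s) : ℕ)| := by
    have : ((min b (2 ^ s) : ℕ) : ℤ) - (min a (2 ^ s) : ℕ) ≠ 0 := by omega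
    exact_mod_cast Int.one_le_abs this
  rw [abscissa, abscissa, ← sub_div, abs_div, abs_of_pos (a := (2 : ℝ) ^ (s + 1)) (by positivity)]
  gcongr

/-- The two-cache input whose keys lie on a parabola, whose values are the rows of `u`, each
repeated `n` times, and whose last query selects row `a`. -/
def hardInput (n d p s : ℕ) (u : Fin n → Fin d → ℝ) (a : ℕ) : Input n d where
  q t := if (t : ℕ) = n * n - 1 then planeVec d (2 ^ p * abscissa s a) (-(2 ^ p / 2)) else 0
  K₁ := Matrix.of fun b => planeVec d (abscissa s b) (abscissa s b ^ 2)
  K₂ := Matrix.of fun _ => planeVec d (1 / 2) (1 / 2)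
  V₁ := Matrix.of u
  V₂ := Matrix.of fun _ _ => 1

variable {n d p s : ℕ} (u : Fin n → Fin d → ℝ) (a : ℕ)

theorem hardInput_keysBounded (hd : 2 ≤ d) : (hardInput n d p s u a).KeysBounded := by
  refine fun i => ⟨l2_planeVec_le_one hd ?_, l2_planeVec_le_one hd (by norm_num)⟩
  have h0 := abscissa_nonneg s i
  have h1 := abscissa_le_half s i
  have h2 : abscissa s i ^ 2 ≤ 1 / 4 := by nlinarith
  nlinarith [sq_nonneg (abscissa s i)]

/-- The squared abscissae are the finest numbers used; their `2 * s + 2` binary digits explain `hp`.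
-/
theorem hardInput_entriesIn (hp : 2 * s + 2 ≤ p) (hu : ∀ b j, u b j = 0 ∨ u b j = 1) :
    (hardInput n d p s u a).EntriesIn (fixedPoint p) := by
  have hP : (1 : ℝ) ≤ 2 ^ p := one_le_pow₀ (by norm_num)
  have m0 : (0 : ℝ) ∈ fixedPoint p := ⟨⟨0, by simp⟩, by simp⟩
  have m1 : (1 : ℝ) ∈ fixedPoint p := by
    simpa using div_mem_fixedPoint (p := p) 1 0 (by omega) (by simpa using hP)
  have mh : (1 / 2 : ℝ) ∈ fixedPoint p := by
    have := div_mem_fixedPoint (p := p) 1 1 (by omega)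
      (by rw [abs_of_nonneg (by positivity)]; norm_num; linarith)
    simpa using this
  have mP : (-(2 ^ p / 2) : ℝ) ∈ fixedPoint p := by
    have := div_mem_fixedPoint (p := p) (-2 ^ p) 1 (by omega)
      (by push_cast; rw [neg_div, abs_neg, abs_of_nonneg (by positivity)]; linarith)
    push_cast at this
    rwa [pow_one, neg_div] at this
  have mx : ∀ b, abscissa s b ∈ fixedPoint p := fun b => by
    have e : abscissa s b = (((min b (2 ^ s) : ℕ) : ℤ) : ℝ) / 2 ^ (s + 1) := by
      rw [abscissa]; simp
    have h0 := abscissa_nonneg s b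
    have h1 := abscissa_le_half s b
    rw [e] at h0 h1 ⊢
    exact div_mem_fixedPoint _ _ (by omega) (by rw [abs_of_nonneg h0]; linarith)
  have mx2 : ∀ b, abscissa s b ^ 2 ∈ fixedPoint p := fun b => by
    have e : abscissa s b ^ 2 = ((((min b (2 ^ s) : ℕ) : ℤ) ^ 2 : ℤ) : ℝ) / 2 ^ (2 * s + 2) := by
      rw [abscissa, div_pow, ← pow_mul, show (s + 1) * 2 = 2 * s + 2 by ring]; simp
    have h0 := abscissa_nonneg s b
    have h1 := abscissa_le_half s b
    have h2 : abscissa s b ^ 2 ≤ 1 := by nlinarith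
    have h3 : 0 ≤ abscissa s b ^ 2 := sq_nonneg _
    rw [e] at h2 h3 ⊢
    exact div_mem_fixedPoint _ _ hp (by rw [abs_of_nonneg h3]; linarith)
  have mPx : 2 ^ p * abscissa s a ∈ fixedPoint p := by
    have e : 2 ^ p * abscissa s a =
        (((2 ^ p * (min a (2 ^ s) : ℕ) : ℤ)) : ℝ) / 2 ^ (s + 1) := by
      rw [abscissa]; push_cast; ring
    have h0 : 0 ≤ 2 ^ p * abscissa s a := mul_nonneg (by positivity) (abscissa_nonneg s a)
    have h1 : 2 ^ p * abscissa s a ≤ 2 ^ p := by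
      refine mul_le_of_le_one_right (by positivity) ((abscissa_le_half s a).trans (by norm_num))
    rw [e] at h0 h1 ⊢
    exact div_mem_fixedPoint _ _ (by omega) (by rw [abs_of_nonneg h0]; linarith)
  refine ⟨fun t j => ?_, fun i j => ⟨planeVec_mem (mx _) (mx2 _) m0 j, planeVec_mem mh mh m0 j,
    ?_, m1⟩⟩
  · simp only [hardInput]
    split_ifs
    · exact planeVec_mem mPx mP m0 j
    · exact m0
  · rcases hu i j with h | h
    · simp [hardInput, h, m0]
    · simp [hardInput, h, m1]

theorem hardInput_lastQuery (hn : 0 < n) : (hardInput n d p s u a).lastQuery =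
    planeVec d (2 ^ p * abscissa s a) (-(2 ^ p / 2)) := by
  rw [Input.lastQuery, dif_pos (Nat.mul_pos hn hn)]
  simp [hardInput]

/-- Completing the square: the score is `2^p / 4 * (2 x_a x_b - x_b²)`. The first summand does not
depend on `b` and cancels in the softmax. -/
theorem hardInput_score (hd : 2 ≤ d) (hn : 0 < n) (b : Fin n × Fin n) :
    (hardInput n d p s u a).keys.mulVec (hardInput n d p s u a).lastQuery b =
      2 ^ p / 4 * abscissa s a ^ 2 + -(2 ^ p / 4 * (abscissa s b.1 - abscissa s a) ^ 2) := by
  rw [hardInput_lastQuery _ _ hn, Matrix.mulVec, dotProduct, sum_fin_eq_add hd]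
  · simp [planeVec, Input.keys, hardInput, colKron]
    ring
  · intro j hj
    simp [planeVec, show (j : ℕ) ≠ 0 by omega, show (j : ℕ) ≠ 1 by omega]

theorem hardInput_target (hd : 2 ≤ d) (hn : 0 < n) (j : Fin d) :
    (hardInput n d p s u a).target j =
      (∑ b : Fin n, u b j * Real.exp (-(2 ^ p / 4 * (abscissa s b - abscissa s a) ^ 2))) /
        ∑ b : Fin n, Real.exp (-(2 ^ p / 4 * (abscissa s b - abscissa s a) ^ 2)) := by
  set ω : Fin n → ℝ := fun b => Real.exp (-(2 ^ p / 4 * (abscissa s b - abscissa s a) ^ 2)) with hω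
  have hne : Nonempty (Fin n) := ⟨⟨0, hn⟩⟩
  have hpos : 0 < ∑ b, ω b := Finset.sum_pos (fun _ _ => Real.exp_pos _) Finset.univ_nonempty
  have hn' : (0 : ℝ) < n := by exact_mod_cast hn
  have hval : ∀ b : Fin n × Fin n, (hardInput n d p s u a).values b j = u b.1 j := by
    intro b; simp [Input.values, hardInput, colKron]
  rw [Input.target, attn_apply]
  simp only [hardInput_score u a hd hn, Real.exp_add, hval, Fintype.sum_prod_type,
    Finset.sum_const, Finset.card_univ, Fintype.card_fin, nsmul_eq_mul]
  have h1 : ∀ b, (n : ℝ) * (Real.exp (2 ^ p / 4 * abscissa s a ^ 2) * ω b * u b j) =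
      n * Real.exp (2 ^ p / 4 * abscissa s a ^ 2) * (u b j * ω b) := fun b => by ring
  have h2 : ∀ b, (n : ℝ) * (Real.exp (2 ^ p / 4 * abscissa s a ^ 2) * ω b) =
      n * Real.exp (2 ^ p / 4 * abscissa s a ^ 2) * ω b := fun b => by ring
  simp only [hω] at h1 h2
  simp only [h1, h2, ← Finset.mul_sum]
  exact mul_div_mul_left _ _ (by positivity)

end HardInstance

/-! ### Decoding the stored bits and the memory lower bound -/

section LowerBound

variable {n d p s : ℕ} (u : Fin n → Fin d → ℝ)

theorem hardInput_weight_le {a b : ℕ} (ha : a < 2 ^ s) (hab : b ≠ a) :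
    Real.exp (-(2 ^ p / 4 * (abscissa s b - abscissa s a) ^ 2)) ≤
      Real.exp (-(2 ^ p / 2 ^ (2 * s + 4))) := by
  refine Real.exp_le_exp.2 (neg_le_neg ?_)
  have h1 := pow_le_pow_left₀ (by positivity) (inv_le_abs_abscissa_sub ha hab) 2
  rw [sq_abs, div_pow, ← pow_mul, one_pow, show (s + 1) * 2 = 2 * s + 2 by ring] at h1
  calc (2 : ℝ) ^ p / 2 ^ (2 * s + 4) = 2 ^ p / 4 * (1 / 2 ^ (2 * s + 2)) := by
        rw [show 2 * s + 4 = 2 * s + 2 + 2 by ring, pow_add 2 (2 * s + 2) 2]; field_simp; norm_num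
    _ ≤ _ := mul_le_mul_of_nonneg_left h1 (by positivity)

/-- The selected row has weight exactly 1; the grid spacing makes every other weight exponentially
small. -/
theorem hardInput_sum_weight_le (a : Fin n) (ha : (a : ℕ) < 2 ^ s) (c : Fin n → ℝ)
    (hc : ∀ b, 0 ≤ c b ∧ c b ≤ 1) :
    ∑ b : Fin n, c b * Real.exp (-(2 ^ p / 4 * (abscissa s b - abscissa s a) ^ 2)) ≤
      c a + n * Real.exp (-(2 ^ p / 2 ^ (2 * s + 4))) := by
  have h : ∀ b ∈ Finset.univ.erase a,
      c b * Real.exp (-(2 ^ p / 4 * (abscissa s b - abscissa s a) ^ 2)) ≤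
        Real.exp (-(2 ^ p / 2 ^ (2 * s + 4))) := fun b hb => by
    have hba : (b : ℕ) ≠ a := fun e => (Finset.mem_erase.1 hb).1 (Fin.ext e)
    exact (mul_le_of_le_one_left (Real.exp_pos _).le (hc b).2).trans (hardInput_weight_le ha hba)
  rw [← Finset.add_sum_erase _ _ (Finset.mem_univ a)]
  refine add_le_add (by simp) ((Finset.sum_le_card_nsmul _ _ _ h).trans ?_)
  rw [nsmul_eq_mul]
  refine mul_le_mul_of_nonneg_right ?_ (Real.exp_pos _).le
  exact_mod_cast (Finset.card_le_univ _).trans_eq (Fintype.card_fin n)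

theorem one_le_hardInput_sum_weight (a : Fin n) :
    1 ≤ ∑ b : Fin n, Real.exp (-(2 ^ p / 4 * (abscissa s b - abscissa s a) ^ 2)) := by
  refine le_trans ?_ (Finset.single_le_sum (fun b _ => (Real.exp_pos _).le) (Finset.mem_univ a))
  simp

theorem hardInput_target_mem_of_zero (hd : 2 ≤ d) (hu : ∀ b j, u b j = 0 ∨ u b j = 1) (a : Fin n)
    (ha : (a : ℕ) < 2 ^ s) (j : Fin d) (h : u a j = 0) :
    0 ≤ (hardInput n d p s u a).target j ∧
      (hardInput n d p s u a).target j ≤ n * Real.exp (-(2 ^ p / 2 ^ (2 * s + 4))) := by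
  have hu' : ∀ b, 0 ≤ u b j ∧ u b j ≤ 1 := fun b => by rcases hu b j with e | e <;> simp [e]
  have h1 := hardInput_sum_weight_le (p := p) a ha (fun b => u b j) hu'
  have h2 := one_le_hardInput_sum_weight (p := p) (s := s) a
  have h3 : 0 ≤ ∑ b : Fin n, u b j *
      Real.exp (-(2 ^ p / 4 * (abscissa s b - abscissa s a) ^ 2)) :=
    Finset.sum_nonneg fun b _ => mul_nonneg (hu' b).1 (Real.exp_pos _).le
  rw [hardInput_target u a hd (Fin.pos a)]
  rw [h, zero_add] at h1
  exact ⟨div_nonneg h3 (by linarith), (div_le_self h3 h2).trans h1⟩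

theorem hardInput_target_ge_of_one (hd : 2 ≤ d) (hu : ∀ b j, u b j = 0 ∨ u b j = 1) (a : Fin n)
    (ha : (a : ℕ) < 2 ^ s) (j : Fin d) (h : u a j = 1) :
    1 ≤ (hardInput n d p s u a).target j * (1 + n * Real.exp (-(2 ^ p / 2 ^ (2 * s + 4)))) := by
  have hu' : ∀ b, 0 ≤ u b j ∧ u b j ≤ 1 := fun b => by rcases hu b j with e | e <;> simp [e]
  have h1 := hardInput_sum_weight_le (p := p) a ha (fun _ => 1) (fun _ => by norm_num)
  have h2 := one_le_hardInput_sum_weight (p := p) (s := s) a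
  have h3 : 1 ≤ ∑ b : Fin n, u b j *
      Real.exp (-(2 ^ p / 4 * (abscissa s b - abscissa s a) ^ 2)) := by
    refine le_trans ?_ (Finset.single_le_sum
      (fun b _ => mul_nonneg (hu' b).1 (Real.exp_pos _).le) (Finset.mem_univ a))
    simp [h]
  rw [hardInput_target u a hd (Fin.pos a), div_mul_eq_mul_div, le_div_iff₀ (by linarith)]
  simp only [one_mul] at h1 ⊢
  have h4 : 0 ≤ (n : ℝ) * Real.exp (-(2 ^ p / 2 ^ (2 * s + 4))) := by positivity
  nlinarith

theorem ofFn_eq_append_last {α : Type*} {N : ℕ} (hN : 0 < N) (f : Fin N → α) :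
    List.ofFn f = List.ofFn (fun t : Fin (N - 1) => f ⟨t, by omega⟩) ++
      [f ⟨N - 1, Nat.sub_lt hN Nat.one_pos⟩] := by
  obtain ⟨N, rfl⟩ : ∃ k, N = k + 1 := ⟨N - 1, by omega⟩
  exact List.ofFn_succ_last

/-- Reduction from INDEX with `d`-bit symbols: everything before the last item encodes `x`, and the
last query names the row to be read. The logarithm of `StreamAlg.index_bound` gives the inequality.
-/
theorem fixedPoint_memory_bound {S : ℕ} (hd : 2 ≤ d) (hn : 2 ^ s ≤ n) (hp : 2 * s + 2 ≤ p) {η : ℝ}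
    (hη0 : 0 < η) (hη1 : η < 1) (hsep : n * Real.exp (-(2 ^ p / 2 ^ (2 * s + 4))) ≤ (1 - η) / 4)
    (σ : Fin (n * n) ≃ Fin n × Fin n) (alg : CacheAlg S d)
    (halg : alg.RelApproximates σ η (fixedPoint p)) :
    ((2 : ℝ) ^ s - 1) * (9 / 10 * d - 1) ≤ S := by
  classical
  have hn0 : 0 < n := (Nat.two_pow_pos s).trans_le hn
  have hN : 0 < n * n := Nat.mul_pos hn0 hn0
  let t₁ : Fin (n * n) := ⟨n * n - 1, Nat.sub_lt hN Nat.one_pos⟩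
  -- The last item brings a value row along with the query. That row is set to zero and excluded
  -- from the index set, so the last item does not depend on `x`.
  let b₁ : Fin n := (σ t₁).1
  let ι : Type := {b : Fin n // (b : ℕ) < 2 ^ s ∧ b ≠ b₁}
  let u : (ι → Fin d → Bool) → Fin n → Fin d → ℝ := fun x b j =>
    if h : (b : ℕ) < 2 ^ s ∧ b ≠ b₁ then (if x ⟨b, h⟩ j then 1 else 0) else 0
  have hu : ∀ x b j, u x b j = 0 ∨ u x b j = 1 := by
    intro x b j
    simp only [u]
    split_ifs <;> simp
  let X : (ι → Fin d → Bool) → ℕ → Input n d := fun x a => hardInput n d p s (u x) a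
  let pre : (ι → Fin d → Bool) → List ((Fin d → ℝ) × (Fin d → ℝ) × (Fin d → ℝ)) := fun x =>
    List.ofFn fun t : Fin (n * n - 1) =>
      (0, (X x 0).keys (σ ⟨t, by omega⟩), (X x 0).values (σ ⟨t, by omega⟩))
  -- The constant `false` is a dummy: queries and keys do not involve the stored bits. Likewise the
  -- 0 in `pre`, as keys, values and earlier queries do not involve the selected row.
  let last : ι → (Fin d → ℝ) × (Fin d → ℝ) × (Fin d → ℝ) := fun i =>
    ((X (fun _ _ => false) i.1).q t₁, (X (fun _ _ => false) i.1).keys (σ t₁), 0)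
  have hstream : ∀ x (i : ι), (X x i.1).stream σ = pre x ++ [last i] := by
    intro x i
    rw [Input.stream, ofFn_eq_append_last hN]
    congr 1
    · simp only [pre]
      congr 1
      funext t
      refine Prod.ext ?_ rfl
      simp only [X, hardInput]
      rw [if_neg (by have := t.2; omega)]
    · simp only [last]
      congr 1
      refine Prod.ext rfl (Prod.ext rfl ?_)
      funext j
      show u x b₁ j * 1 = 0
      simp [u]
  -- A bit 1 gives a target above `1/2`, hence output above `(1 - η) / 2`; a bit 0 gives output at
  -- most `(1 + η) * (1 - η) / 4`, which is smaller.
  let decode : (Fin d → ℝ) → Fin d → Bool := fun o j => decide ((1 - η) / 2 < o j)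
  have hdec : ∀ x (i : ι), (9 / 10 : ℝ≥0∞) ≤ alg.prob (pre x ++ [last i]) {o | decode o = x i} := by
    intro x i
    rw [← hstream]
    refine (halg (X x i.1) (hardInput_entriesIn _ _ hp (hu x)) (hardInput_keysBounded _ _ hd)).trans
      (MeasureTheory.measure_mono ?_)
    intro o ho
    refine funext fun j => ?_
    have hoj := abs_le.1 (ho j)
    have hui : u x i.1 j = if x i j then 1 else 0 := by
      simp only [u]
      rw [dif_pos i.2]
    by_cases hx : x i j = true
    · rw [hx] at hui ⊢
      have h1 := hardInput_target_ge_of_one (p := p) (u x) hd (hu x) i.1 i.2.1 j (by simpa using hui)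
      have h1' : 1 ≤ (X x i.1).target j * (1 + n * Real.exp (-(2 ^ p / 2 ^ (2 * s + 4)))) := h1
      have h2 : 1 / 2 < (X x i.1).target j := by
        by_contra hcon
        push Not at hcon
        have : 0 ≤ (n : ℝ) * Real.exp (-(2 ^ p / 2 ^ (2 * s + 4))) := by positivity
        nlinarith
      rw [abs_of_pos (by linarith)] at hoj
      refine decide_eq_true ?_
      nlinarith [hoj.1]
    · rw [Bool.not_eq_true] at hx
      rw [hx] at hui ⊢
      obtain ⟨h1, h2⟩ := hardInput_target_mem_of_zero (p := p) (u x) hd (hu x) i.1 i.2.1 j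
        (by simpa using hui)
      have h1' : 0 ≤ (X x i.1).target j := h1
      have h2' : (X x i.1).target j ≤ n * Real.exp (-(2 ^ p / 2 ^ (2 * s + 4))) := h2
      rw [abs_of_nonneg h1'] at hoj
      refine decide_eq_false (not_lt.2 ?_)
      nlinarith [hoj.2]
  have hidx := alg.index_bound pre last decode hdec
  have hcardι : (2 : ℝ) ^ s - 1 ≤ Fintype.card ι := by
    have h1 : Finset.univ.filter (fun b : Fin n => (b : ℕ) < 2 ^ s ∧ b ≠ b₁) =
        (Finset.univ.filter fun b : Fin n => (b : ℕ) < 2 ^ s).erase b₁ := by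
      ext b; simp [and_comm]
    have h2 : (Finset.univ.filter fun b : Fin n => (b : ℕ) < 2 ^ s).card = 2 ^ s := by
      rw [Fin.card_filter_val_lt, min_eq_right hn]
    have h3 : 2 ^ s ≤ Fintype.card ι + 1 := by
      have h4 := Finset.pred_card_le_card_erase (a := b₁)
        (s := Finset.univ.filter fun b : Fin n => (b : ℕ) < 2 ^ s)
      rw [← h1, h2, ← Fintype.card_subtype] at h4
      exact Nat.sub_le_iff_le_add.1 h4
    have h4 : (2 : ℝ) ^ s ≤ Fintype.card ι + 1 := by exact_mod_cast h3
    linarith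
  have hQ : Real.log (Fintype.card (Fin d → Bool)) = d * Real.log 2 := by
    simp [Real.log_pow]
  rw [hQ, ← Real.le_log_iff_exp_le (by positivity),
    Real.log_mul (by positivity) (by positivity), Real.log_pow, Real.log_pow] at hidx
  have hl2 : 0 < Real.log 2 := Real.log_pos (by norm_num)
  have hfin : (Fintype.card ι : ℝ) * (9 / 10 * d - 1) ≤ S := by
    refine le_of_mul_le_mul_right ?_ hl2
    linarith
  have hd2 : (2 : ℝ) ≤ d := by exact_mod_cast hd
  exact (mul_le_mul_of_nonneg_right hcardι (by linarith)).trans hfin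

/-- With `x = 2 ^ s`, this dominates the total weight of the unselected rows: `n ≤ 16 x⁴` and each
exponent is at least `x² / 16`. -/
theorem tendsto_pow_mul_exp_neg_zero :
    Tendsto (fun x : ℝ => 16 * x ^ 4 * Real.exp (-(x ^ 2 / 16))) atTop (nhds 0) := by
  have h1 : Tendsto (fun x : ℝ => x ^ 2 / 16) atTop atTop :=
    (tendsto_pow_atTop two_ne_zero).atTop_div_const (by norm_num)
  have h2 := ((Real.tendsto_pow_mul_exp_neg_atTop_nhds_zero 2).comp h1).const_mul (16 ^ 3 : ℝ)
  rw [mul_zero] at h2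
  refine h2.congr fun x => ?_
  simp only [Function.comp]
  ring

theorem fixedPoint_space_lower_bound : ∃ c : ℝ, 0 < c ∧ ∀ d : ℕ → ℕ, (∀ n, 2 ≤ d n) →
    (fun n => (d n : ℝ)) =o[atTop] (fun n : ℕ => Real.log n) →
    ∀ η : ℝ, 0 < η → η < 1 →
    ∀ᶠ n : ℕ in atTop, ∀ p : ℕ, Real.logb 2 n ≤ p →
      ∀ (σ : Fin (n * n) ≃ Fin n × Fin n) (S : ℕ) (alg : CacheAlg S (d n)),
        alg.RelApproximates σ η (fixedPoint p) → c * (d n * Real.exp (d n)) ≤ S := by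
  refine ⟨1 / 10, by norm_num, fun d hd hdo η hη0 hη1 => ?_⟩
  -- With `2 ^ s` of order `n ^ (1/4)`, the query scale `2 ^ p ≥ n` exceeds the inverse squared grid
  -- spacing by a power of `n`, so the softmax isolates one row.
  have hs : Tendsto (fun n : ℕ => Nat.log 2 n / 4) atTop atTop := by
    refine tendsto_atTop.2 fun k => ?_
    filter_upwards [eventually_ge_atTop (2 ^ (4 * k))] with n hn
    rw [Nat.le_div_iff_mul_le (by norm_num), mul_comm]
    exact Nat.le_log_of_pow_le (by norm_num) hn
  have hpow : Tendsto (fun n : ℕ => (2 : ℝ) ^ (Nat.log 2 n / 4)) atTop atTop :=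
    (tendsto_pow_atTop_atTop_of_one_lt (by norm_num)).comp hs
  filter_upwards [hdo.bound (show (0 : ℝ) < 1 / 8 by norm_num), hs.eventually_ge_atTop 1,
    hpow.eventually_ge_atTop 4, (tendsto_pow_mul_exp_neg_zero.comp hpow).eventually_le_const
      (show (0 : ℝ) < (1 - η) / 4 by linarith), eventually_gt_atTop 0]
    with n hdn hs1 hM hsep hn p hp σ S alg halg
  simp only [Function.comp] at hsep
  set s := Nat.log 2 n / 4 with hsdef
  set M : ℝ := 2 ^ s with hMdef
  have hn' : (0 : ℝ) < n := by exact_mod_cast hn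
  have hM4 : M ^ 4 ≤ n := by
    have h1 : 2 ^ (s * 4) ≤ n :=
      (Nat.pow_le_pow_right (by norm_num) (Nat.div_mul_le_self _ _)).trans
        (Nat.pow_log_le_self 2 hn.ne')
    rw [hMdef, ← pow_mul]
    exact_mod_cast h1
  have hnM : (n : ℝ) ≤ 16 * M ^ 4 := by
    have h1 : n ≤ 2 ^ (s * 4 + 4) :=
      (Nat.lt_pow_succ_log_self (by norm_num) n).le.trans
        (Nat.pow_le_pow_right (by norm_num) (by omega))
    have h2 : (n : ℝ) ≤ 2 ^ (s * 4 + 4) := by exact_mod_cast h1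
    rw [pow_add, pow_mul] at h2
    linarith
  have hnp : (n : ℝ) ≤ 2 ^ p := by
    rw [Real.logb_le_iff_le_rpow (by norm_num) hn', Real.rpow_natCast] at hp
    exact hp
  have hsp : 4 * s ≤ p := by
    have h1 : (2 : ℝ) ^ (s * 4) ≤ 2 ^ p := by rw [pow_mul]; exact hM4.trans hnp
    have := (pow_le_pow_iff_right₀ (by norm_num : (1 : ℝ) < 2)).1 h1
    omega
  have hsn : 2 ^ s ≤ n := by
    have h1 : M ≤ n := (le_self_pow₀ (by linarith) (by norm_num)).trans hM4
    rw [hMdef] at h1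
    exact_mod_cast h1
  have hgap : M ^ 2 / 16 ≤ 2 ^ p / 2 ^ (2 * s + 4) := by
    rw [div_le_div_iff₀ (by norm_num) (by positivity), pow_add, mul_comm 2 s, pow_mul]
    nlinarith
  have hsep' : n * Real.exp (-(2 ^ p / 2 ^ (2 * s + 4))) ≤ (1 - η) / 4 :=
    (mul_le_mul hnM (Real.exp_le_exp.2 (neg_le_neg hgap)) (Real.exp_pos _).le
      (by positivity)).trans hsep
  have hbound := fixedPoint_memory_bound (hd n) hsn (by omega) hη0 hη1 hsep' σ alg halg
  have hlogn : 0 ≤ Real.log n := Real.log_natCast_nonneg n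
  rw [Real.norm_of_nonneg (Nat.cast_nonneg _), Real.norm_of_nonneg hlogn] at hdn
  -- From `d ≤ log n / 8`, `exp d` is at most `n ^ (1/8)`; `M ≥ 4` absorbs the rounding factor 16.
  have hexp : Real.exp (d n) ≤ M := by
    have h1 : Real.exp (d n) ^ 8 ≤ M ^ 8 := by
      calc Real.exp (d n) ^ 8 = Real.exp ((8 : ℕ) * (d n : ℝ)) := (Real.exp_nat_mul _ _).symm
        _ ≤ Real.exp (Real.log n) := Real.exp_le_exp.2 (by push_cast; linarith)
        _ = n := Real.exp_log hn'
        _ ≤ 16 * M ^ 4 := hnM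
        _ ≤ M ^ 4 * M ^ 4 := by
            refine mul_le_mul_of_nonneg_right ?_ (by positivity)
            have : (4 : ℝ) ^ 2 ≤ M ^ 2 := pow_le_pow_left₀ (by norm_num) hM 2
            nlinarith
        _ = M ^ 8 := by ring
    exact le_of_pow_le_pow_left₀ (by norm_num) (by positivity) h1
  have hd2 : (2 : ℝ) ≤ d n := by exact_mod_cast hd n
  calc 1 / 10 * (d n * Real.exp (d n)) ≤ 1 / 10 * (d n * M) := by gcongr
    _ ≤ (M - 1) * (9 / 10 * d n - 1) := by nlinarith
    _ ≤ S := hbound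

end LowerBound

end TensorCache

end

theorem theorem6p4 :
    -- SubGen2Cache: space `Õ(d e^d)`
    (∀ c : ℝ, ∃ (C : ℝ) (κ : ℕ), ∀ (d : ℕ → ℕ) (r : ℕ → ℝ), (∀ n, 2 ≤ d n) →
      (fun n => (d n : ℝ)) =o[atTop] (fun n : ℕ => Real.log n) →
      IsBigOWith c atTop r (fun n : ℕ => Real.log (Real.log n)) →
      ∀ᶠ n : ℕ in atTop, ∀ ε : ℝ, 0 < ε → ∀ w : ℕ, 1 ≤ w →
        ∀ A : Finset ℝ, A.card ≤ 2 ^ w →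
          ∃ S : ℕ,
            (S : ℝ) ≤ C * w * (ε ^ 2)⁻¹ * (d n * Real.exp (d n)) * Real.log n ^ κ ∧
            ∃ alg : CacheAlg S (d n), alg.Approximates n (r n) ε (A : Set ℝ)) ∧
    -- essential optimality: `Ω(d e^d)` bits are needed
    (∃ c : ℝ, 0 < c ∧ ∀ d : ℕ → ℕ, (∀ n, 2 ≤ d n) →
      (fun n => (d n : ℝ)) =o[atTop] (fun n : ℕ => Real.log n) →
      ∀ η : ℝ, 0 < η → η < 1 →
      ∀ᶠ n : ℕ in atTop, ∀ p : ℕ, Real.logb 2 n ≤ p →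
        ∀ (σ : Fin (n * n) ≃ Fin n × Fin n) (S : ℕ) (alg : CacheAlg S (d n)),
          alg.RelApproximates σ η (fixedPoint p) → c * (d n * Real.exp (d n)) ≤ S) :=
  ⟨subGen2Cache_space, fixedPoint_space_lower_bound⟩
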